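/- All manifolds are $C^\infty$, Hausdorff and second countable, without boundary, with $C^\infty$ Riemannian metrics. For a Riemannian manifold $M$ let $\bar\nabla$ be its Levi-Civita connection and $\bar R(X,Y)=\bar\nabla_X\bar\nabla_Y-\bar\nabla_Y\bar\nabla_X-\bar\nabla_{[X,Y]}$ its curvature tensor. $M$ has constant sectional curvature if there is $k\in\mathbb R$ such that every plane tangent to $M$, at every point, has sectional curvature $k$; $M$ is Einstein if there is $\rho\in\mathbb R$ with $\mathrm{Ric}=\rho\langle\cdot,\cdot\rangle$ on all of $M$. Let $f:S\to M$ be an isometric immersion of an $r$-dimensional Riemannian manifold $S$, and regard $T_pS$ as a subspace of $T_{f(p)}M$ through $df_p$. The immersion $f$ is *special* if, for every $p\in S$, every orthonormal basis $v_1,\dots,v_r$ of $T_pS$ and every $w\in T_pS$, one has $\sum_{i=1}^r\bar R(v_i,w)v_i\in T_pS$. It is *very special* if $\bar R(v,w)v\in T_pS$ for every $p\in S$ and all $v,w\in T_pS$. $M$ satisfies the *axiom of special* (respectively *very special*) *$r$-submanifolds* if for every $p\in M$ and every $r$-dimensional linear subspace $W\subset T_pM$ there is a special (respectively very special) immersed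 $r$-dimensional submanifold $S$ through $p$ with $T_pS=W$. **Theorem.** Let $M$ be a connected Riemannian manifold of dimension $m\ge 3$. (a) If $M$ satisfies the axiom of special $r$-submanifolds for some $2\le r\le m-1$, then $M$ has constant sectional curvature if $r\le m-2$, and $M$ is Einstein if $r=m-1$. (b) If $M$ satisfies the axiom of very special $(m-1)$-submanifolds, then $M$ has constant sectional curvature. Conversely, let $M$ be a Riemannian manifold of any dimension $m$, connected or not. If $M$ has constant sectional curvature, then every isometric immersion of a Riemannian manifold (of any dimension) into $M$ is very special. If $M$ is Einstein, then every isometric immersion of an $(m-1)$-dimensional Riemannian manifold into $M$ is special. -/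

import Mathlib

open Bundle Manifold VectorField FiberBundle
open scoped ContDiff

noncomputable section

set_option linter.unusedSectionVars false

namespace RiemGeom

section LeviCivita

variable {E : Type*} [NormedAddCommGroup E] [NormedSpace ℝ E]
  {H : Type*} [TopologicalSpace H] (I : ModelWithCorners ℝ E H)
  {M : Type*} [TopologicalSpace M] [ChartedSpace H M] [IsManifold I ∞ M]
  [RiemannianBundle (fun x : M => TangentSpace I x)]

/-- The right-hand side of the Koszul formula, i.e. the expression which has to equal
`2 ⟨∇_X Y, Z⟩` at `x` for the Levi-Civita connection. -/
def koszul (X Y Z : Π x : M, TangentSpace I x) (x : M) : ℝ :=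
  d% (fun y => inner ℝ (Y y) (Z y)) x (X x)
    + d% (fun y => inner ℝ (X y) (Z y)) x (Y x)
    - d% (fun y => inner ℝ (X y) (Y y)) x (Z x)
    + inner ℝ (mlieBracket I X Y x) (Z x)
    - inner ℝ (mlieBracket I X Z x) (Y x)
    - inner ℝ (mlieBracket I Y Z x) (X x)

variable [FiniteDimensional ℝ E]
  [IsContMDiffRiemannianBundle I ∞ E (fun x : M => TangentSpace I x)]

theorem mdifferentiableAt_inner {X Y : Π x : M, TangentSpace I x} {x : M}
    (hX : MDiffAt (T% X) x) (hY : MDiffAt (T% Y) x) :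
    MDiffAt (fun y => inner ℝ (X y) (Y y)) x :=
  MDifferentiableAt.inner_bundle (IB := I) (F := E) (E := fun x : M => TangentSpace I x)
    (b := fun y => y) hX hY

theorem koszul_tensorial_left (Y Z : Π x : M, TangentSpace I x) (x : M)
    (hY : MDiffAt (T% Y) x) (hZ : MDiffAt (T% Z) x) :
    TensorialAt I E (fun X : Π x : M, TangentSpace I x => koszul I X Y Z x) x where
  smul {f X} hf hX := by
    have h1 := mdifferentiableAt_inner I hX hZ
    have h2 := mdifferentiableAt_inner I hX hY
    simp [koszul, mvfderiv_fun_mul hf h1, mvfderiv_fun_mul hf h2,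
      mlieBracket_smul_left hf hX, inner_add_left, inner_smul_left, inner_smul_right]
    ring
  add {X X'} hX hX' := by
    have h1 := mdifferentiableAt_inner I hX hZ
    have h2 := mdifferentiableAt_inner I hX hY
    have h1' := mdifferentiableAt_inner I hX' hZ
    have h2' := mdifferentiableAt_inner I hX' hY
    simp [koszul, mvfderiv_fun_add h1 h1', mvfderiv_fun_add h2 h2',
      mlieBracket_add_left hX hX', inner_add_left, inner_add_right]
    ring

theorem koszul_tensorial_right (X Y : Π x : M, TangentSpace I x) (x : M)
    (hX : MDiffAt (T% X) x) (hY : MDiffAt (T% Y) x) :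
    TensorialAt I E (fun Z : Π x : M, TangentSpace I x => koszul I X Y Z x) x where
  smul {f Z} hf hZ := by
    have h1 := mdifferentiableAt_inner I hY hZ
    have h2 := mdifferentiableAt_inner I hX hZ
    simp [koszul, mvfderiv_fun_mul hf h1, mvfderiv_fun_mul hf h2,
      mlieBracket_smul_right hf hZ, inner_add_left, inner_smul_left, inner_smul_right]
    rw [real_inner_comm (Z x) (Y x), real_inner_comm (X x) (Z x)]
    ring
  add {Z Z'} hZ hZ' := by
    have h1 := mdifferentiableAt_inner I hY hZ
    have h2 := mdifferentiableAt_inner I hX hZ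
    have h1' := mdifferentiableAt_inner I hY hZ'
    have h2' := mdifferentiableAt_inner I hX hZ'
    simp [koszul, mvfderiv_fun_add h1 h1', mvfderiv_fun_add h2 h2',
      mlieBracket_add_right hZ hZ', inner_add_left, inner_add_right]
    ring

/-- The bilinear form `(u, w) ↦ 2 ⟨∇_u Y, w⟩` on `T_x M`. -/
def koszulForm (Y : Π x : M, TangentSpace I x) (x : M) (hY : MDiffAt (T% Y) x) :
    TangentSpace I x →L[ℝ] TangentSpace I x →L[ℝ] ℝ :=
  TensorialAt.mkHom₂ (fun X Z => koszul I X Y Z x) x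
    (fun Z hZ => koszul_tensorial_left I Y Z x hY hZ)
    (fun X hX => koszul_tensorial_right I X Y x hX hY)

instance finiteDimensional_tangentSpace (x : M) : FiniteDimensional ℝ (TangentSpace I x) :=
  inferInstanceAs (FiniteDimensional ℝ E)

instance completeSpace_tangentSpace (x : M) : CompleteSpace (TangentSpace I x) :=
  FiniteDimensional.complete ℝ (TangentSpace I x)

open Classical in
/-- `u ↦ ∇_u Y` at `x`: the vector `∇_u Y` is the one with `2 ⟨∇_u Y, w⟩` given by the Koszul
formula. If `Y` is not differentiable at `x`, the value is `0` by convention. -/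
def leviCivitaFun (Y : Π x : M, TangentSpace I x) (x : M) :
    TangentSpace I x →L[ℝ] TangentSpace I x :=
  if hY : MDiffAt (T% Y) x then
    LinearMap.toContinuousLinearMap
      { toFun := fun u =>
          (1 / 2 : ℝ) • (InnerProductSpace.toDual ℝ (TangentSpace I x)).symm (koszulForm I Y x hY u)
        map_add' := fun u v => by simp
        map_smul' := fun c u => by simp [smul_comm c] }
  else 0

theorem inner_leviCivitaFun {X Y Z : Π x : M, TangentSpace I x} {x : M}
    (hX : MDiffAt (T% X) x) (hY : MDiffAt (T% Y) x) (hZ : MDiffAt (T% Z) x) :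
    inner ℝ (leviCivitaFun I Y x (X x)) (Z x) = (1 / 2 : ℝ) * koszul I X Y Z x := by
  have := TensorialAt.mkHom₂_apply (fun Z hZ => koszul_tensorial_left I Y Z x hY hZ)
    (fun X hX => koszul_tensorial_right I X Y x hX hY) hX hZ
  simp [leviCivitaFun, hY, koszulForm, inner_smul_left]
  exact this

theorem ext_inner_field {x : M} {u v : TangentSpace I x}
    (h : ∀ Z : Π x : M, TangentSpace I x, MDiffAt (T% Z) x →
      inner ℝ u (Z x) = inner ℝ v (Z x)) : u = v := by
  refine ext_inner_right ℝ fun w => ?_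
  simpa using h (extend E w) (mdifferentiableAt_extend ..)

theorem isCovariantDerivativeOn_leviCivitaFun :
    IsCovariantDerivativeOn (I := I) E
      (leviCivitaFun I : (Π x : M, TangentSpace I x) → _) Set.univ where
  add {Y Y' x} hY hY' _ := by
    have hs : MDiffAt (T% (Y + Y')) x := mdifferentiableAt_add_section hY hY'
    ext1 u
    refine ext_inner_field I fun Z hZ => ?_
    have hX := mdifferentiableAt_extend I E u
    have hu : u = extend E u x := by simp
    generalize extend E u = X at hX hu
    subst hu
    rw [add_apply, inner_add_left, inner_leviCivitaFun I hX hs hZ,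
      inner_leviCivitaFun I hX hY hZ, inner_leviCivitaFun I hX hY' hZ]
    have h1 := mdifferentiableAt_inner I hX hY
    have h2 := mdifferentiableAt_inner I hY hZ
    have h1' := mdifferentiableAt_inner I hX hY'
    have h2' := mdifferentiableAt_inner I hY' hZ
    simp [koszul, mvfderiv_fun_add h1 h1', mvfderiv_fun_add h2 h2',
      mlieBracket_add_left hY hY', mlieBracket_add_right hY hY', inner_add_left, inner_add_right]
    ring
  leibniz {Y f x} hY hf _ := by
    have hs : MDiffAt (T% (f • Y)) x := hf.smul_section hY
    ext1 u
    refine ext_inner_field I fun Z hZ => ?_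
    have hX := mdifferentiableAt_extend I E u
    have hu : u = extend E u x := by simp
    generalize extend E u = X at hX hu
    subst hu
    simp only [add_apply, inner_add_left, smul_apply,
      inner_smul_left, inner_leviCivitaFun I hX hs hZ, inner_leviCivitaFun I hX hY hZ,
      ContinuousLinearMap.smulRight_apply]
    have h1 := mdifferentiableAt_inner I hX hY
    have h2 := mdifferentiableAt_inner I hY hZ
    simp [koszul, mvfderiv_fun_mul hf h1, mvfderiv_fun_mul hf h2,
      mlieBracket_smul_left hf hY, mlieBracket_smul_right hf hY,
      inner_add_left, inner_smul_left, inner_smul_right]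
    rw [real_inner_comm (X x) (Y x)]
    ring

variable (M) in
/-- The Levi-Civita connection of a Riemannian manifold: `leviCivita I M Y x u` is `∇_u Y`. -/
def leviCivita : CovariantDerivative I E (fun x : M => TangentSpace I x) :=
  ⟨leviCivitaFun I, isCovariantDerivativeOn_leviCivitaFun I⟩

theorem leviCivita_torsion : (leviCivita I M).torsion = 0 := by
  rw [CovariantDerivative.torsion_eq_zero_iff]
  intro X Y x hX hY
  refine ext_inner_field I fun Z hZ => ?_
  change inner ℝ (leviCivitaFun I Y x (X x) - leviCivitaFun I X x (Y x)) (Z x) = _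
  rw [inner_sub_left, inner_leviCivitaFun I hX hY hZ, inner_leviCivitaFun I hY hX hZ]
  simp only [koszul, mlieBracket_swap_apply (V := Y) (W := X), inner_neg_left,
    real_inner_comm]
  ring

theorem leviCivita_metric {X Y Z : Π x : M, TangentSpace I x} {x : M}
    (hX : MDiffAt (T% X) x) (hY : MDiffAt (T% Y) x) (hZ : MDiffAt (T% Z) x) :
    d% (fun y => inner ℝ (Y y) (Z y)) x (X x) =
      inner ℝ (leviCivita I M Y x (X x)) (Z x) + inner ℝ (Y x) (leviCivita I M Z x (X x)) := by
  rw [real_inner_comm _ (Y x)]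
  change _ = inner ℝ (leviCivitaFun I Y x (X x)) (Z x) + inner ℝ (leviCivitaFun I Z x (X x)) (Y x)
  rw [inner_leviCivitaFun I hX hY hZ, inner_leviCivitaFun I hX hZ hY]
  simp only [koszul, mlieBracket_swap_apply (V := Z) (W := Y), inner_neg_left]
  have hc : (fun y => inner ℝ (Z y) (Y y)) = fun y => inner ℝ (Y y) (Z y) :=
    funext fun y => real_inner_comm _ _
  rw [hc]
  ring

/-- The curvature operator `R(X, Y) Z = ∇_X ∇_Y Z - ∇_Y ∇_X Z - ∇_{[X, Y]} Z` on vector fields. -/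
def curvatureField (X Y Z : Π x : M, TangentSpace I x) (x : M) : TangentSpace I x :=
  leviCivita I M (fun y => leviCivita I M Z y (Y y)) x (X x)
    - leviCivita I M (fun y => leviCivita I M Z y (X y)) x (Y x)
    - leviCivita I M Z x (mlieBracket I X Y x)

/-- The curvature tensor `R(u, v) w` on `T_x M`, computed on extensions of `u`, `v`, `w` to vector
fields which are smooth near `x`. -/
def curvature (x : M) (u v w : TangentSpace I x) : TangentSpace I x :=
  curvatureField I (extend E u) (extend E v) (extend E w) x

/-- The sectional curvature of the plane spanned by `u` and `v` (linearly independent). -/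
def sectionalCurvature (x : M) (u v : TangentSpace I x) : ℝ :=
  inner ℝ (curvature I x u v v) u / (‖u‖ ^ 2 * ‖v‖ ^ 2 - (inner ℝ u v) ^ 2)

variable (M) in
/-- All planes tangent to `M` have the same sectional curvature. -/
def HasConstantSectionalCurvature : Prop :=
  ∃ k : ℝ, ∀ (x : M) (u v : TangentSpace I x), LinearIndependent ℝ ![u, v] →
    sectionalCurvature I x u v = k

/-- The Ricci form: `Ric(u, w)` is the trace of `v ↦ R(v, u) w`. -/
def ricci (x : M) (u w : TangentSpace I x) : ℝ :=
  ∑ i, inner ℝ (curvature I x (stdOrthonormalBasis ℝ (TangentSpace I x) i) u w)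
    (stdOrthonormalBasis ℝ (TangentSpace I x) i)

variable (M) in
/-- `M` is Einstein: `Ric = ρ ⟨·, ·⟩` for a constant `ρ`. -/
def IsEinstein : Prop :=
  ∃ ρ : ℝ, ∀ (x : M) (u w : TangentSpace I x), ricci I x u w = ρ * inner ℝ u w

end LeviCivita

section Immersions

variable {E : Type*} [NormedAddCommGroup E] [NormedSpace ℝ E] [FiniteDimensional ℝ E]
  {H : Type*} [TopologicalSpace H] (I : ModelWithCorners ℝ E H)
  {M : Type*} [TopologicalSpace M] [ChartedSpace H M] [IsManifold I ∞ M]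
  [RiemannianBundle (fun x : M => TangentSpace I x)]
  [IsContMDiffRiemannianBundle I ∞ E (fun x : M => TangentSpace I x)]
  (r : ℕ) {S : Type*} [TopologicalSpace S] [ChartedSpace (EuclideanSpace ℝ (Fin r)) S]
  [RiemannianBundle (fun p : S => TangentSpace (𝓡 r) p)]

/-- `f : S → M` is a (smooth) isometric immersion of an `r`-dimensional Riemannian manifold. -/
def IsIsometricImmersion (f : S → M) : Prop :=
  ContMDiff (𝓡 r) I ∞ f ∧
    ∀ (p : S) (u v : TangentSpace (𝓡 r) p),
      inner ℝ (mfderiv (𝓡 r) I f p u) (mfderiv (𝓡 r) I f p v) = inner ℝ u v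

/-- `T_p S`, seen inside `T_{f p} M` through the differential of `f`. -/
def tangentImage (f : S → M) (p : S) : Submodule ℝ (TangentSpace I (f p)) :=
  LinearMap.range (mfderiv (𝓡 r) I f p).toLinearMap

/-- `f` is special: `∑ i, R(v_i, w) v_i ∈ T_p S` for all `p`, all orthonormal bases `(v_i)` of
`T_p S` and all `w ∈ T_p S`. -/
def IsSpecial (f : S → M) : Prop :=
  ∀ (p : S) (v : OrthonormalBasis (Fin r) ℝ (TangentSpace (𝓡 r) p)) (w : TangentSpace (𝓡 r) p),
    ∑ i, curvature I (f p) (mfderiv (𝓡 r) I f p (v i)) (mfderiv (𝓡 r) I f p w)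
      (mfderiv (𝓡 r) I f p (v i)) ∈ tangentImage I r f p

/-- `f` is very special: `R(v, w) v ∈ T_p S` for all `p` and all `v, w ∈ T_p S`. -/
def IsVerySpecial (f : S → M) : Prop :=
  ∀ (p : S) (v w : TangentSpace (𝓡 r) p),
    curvature I (f p) (mfderiv (𝓡 r) I f p v) (mfderiv (𝓡 r) I f p w)
      (mfderiv (𝓡 r) I f p v) ∈ tangentImage I r f p

end Immersions

section Axioms

universe u

variable {E : Type*} [NormedAddCommGroup E] [NormedSpace ℝ E] [FiniteDimensional ℝ E]
  {H : Type*} [TopologicalSpace H] (I : ModelWithCorners ℝ E H)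
  (M : Type u) [TopologicalSpace M] [ChartedSpace H M] [IsManifold I ∞ M]
  [RiemannianBundle (fun x : M => TangentSpace I x)]
  [IsContMDiffRiemannianBundle I ∞ E (fun x : M => TangentSpace I x)]

/-- The axiom of special `r`-submanifolds: every `r`-dimensional subspace `W` of every tangent
space `T_p M` is the tangent space at `p` of a special (immersed) `r`-dimensional submanifold. -/
def AxiomSpecial (r : ℕ) : Prop :=
  ∀ (p : M) (W : Submodule ℝ (TangentSpace I p)), Module.finrank ℝ W = r →
    ∃ (S : Type u) (_ : TopologicalSpace S) (_ : T2Space S) (_ : SecondCountableTopology S)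
      (_ : ChartedSpace (EuclideanSpace ℝ (Fin r)) S) (_ : IsManifold (𝓡 r) ∞ S)
      (_ : RiemannianBundle (fun q : S => TangentSpace (𝓡 r) q))
      (_ : IsContMDiffRiemannianBundle (𝓡 r) ∞ (EuclideanSpace ℝ (Fin r))
        (fun q : S => TangentSpace (𝓡 r) q))
      (f : S → M), IsIsometricImmersion I r f ∧ IsSpecial I r f ∧
        ∃ (q : S) (hq : f q = p), hq ▸ tangentImage I r f q = W

/-- The axiom of very special `r`-submanifolds: every `r`-dimensional subspace `W` of every tangent
space `T_p M` is the tangent space at `p` of a very special (immersed) `r`-dimensional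
submanifold. -/
def AxiomVerySpecial (r : ℕ) : Prop :=
  ∀ (p : M) (W : Submodule ℝ (TangentSpace I p)), Module.finrank ℝ W = r →
    ∃ (S : Type u) (_ : TopologicalSpace S) (_ : T2Space S) (_ : SecondCountableTopology S)
      (_ : ChartedSpace (EuclideanSpace ℝ (Fin r)) S) (_ : IsManifold (𝓡 r) ∞ S)
      (_ : RiemannianBundle (fun q : S => TangentSpace (𝓡 r) q))
      (_ : IsContMDiffRiemannianBundle (𝓡 r) ∞ (EuclideanSpace ℝ (Fin r))
        (fun q : S => TangentSpace (𝓡 r) q))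
      (f : S → M), IsIsometricImmersion I r f ∧ IsVerySpecial I r f ∧
        ∃ (q : S) (hq : f q = p), hq ▸ tangentImage I r f q = W

end Axioms

end RiemGeom

end

open Bundle Manifold VectorField FiberBundle
open scoped ContDiff

noncomputable section

set_option linter.unusedSectionVars false

namespace RiemGeom

open Filter Topology

theorem finrank_tangentSpace {E : Type*} [NormedAddCommGroup E] [NormedSpace ℝ E]
    {H : Type*} [TopologicalSpace H] {I : ModelWithCorners ℝ E H}
    {M : Type*} [TopologicalSpace M] [ChartedSpace H M] (x : M) :
    Module.finrank ℝ (TangentSpace I x) = Module.finrank ℝ E := rfl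

section Fields

variable {E : Type*} [NormedAddCommGroup E] [NormedSpace ℝ E] [FiniteDimensional ℝ E]
  {H : Type*} [TopologicalSpace H] {I : ModelWithCorners ℝ E H}
  {M : Type*} [TopologicalSpace M] [ChartedSpace H M] [IsManifold I ∞ M]

/-- A vector field which is smooth near `x` coincides near `x` with a globally smooth one. -/
theorem exists_smooth_field_eventuallyEq [T2Space M] {x : M} {σ : Π x : M, TangentSpace I x}
    (hσ : ∀ᶠ y in 𝓝 x, CMDiffAt ∞ (T% σ) y) :
    ∃ X : Cₛ^∞⟮I; E, (TangentSpace I : M → Type _)⟯, ∀ᶠ y in 𝓝 x, X y = σ y := by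
  obtain ⟨u, hu, huo, hxu⟩ := eventually_nhds_iff.1 hσ
  obtain ⟨f, -, hf⟩ := (SmoothBumpFunction.nhds_basis_tsupport (I := I) x).mem_iff.1
    (huo.mem_nhds hxu)
  refine ⟨⟨(f : M → ℝ) • σ, f.contMDiff.contMDiffOn.smul_section_of_tsupport huo hf
    fun y hy => (hu y hy).contMDiffWithinAt⟩, ?_⟩
  filter_upwards [f.eventuallyEq_one] with y hy
  simp [hy]

theorem eventually_contMDiffAt_extend {x : M} (v : TangentSpace I x) :
    ∀ᶠ y in 𝓝 x, CMDiffAt ∞ (T% (extend E v)) y := by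
  obtain ⟨s, hs, h⟩ := exists_contMDiffOn_extend (k := ∞) I E v
  filter_upwards [eventually_mem_nhds_iff.2 hs] with y hy
  exact h.contMDiffAt hy

theorem exists_smooth_field_eq_extend [T2Space M] {x : M} (v : TangentSpace I x) :
    ∃ X : Cₛ^∞⟮I; E, (TangentSpace I : M → Type _)⟯, ∀ᶠ y in 𝓝 x, X y = extend E v y :=
  exists_smooth_field_eventuallyEq (eventually_contMDiffAt_extend v)

theorem exists_smooth_field [T2Space M] {x : M} (v : TangentSpace I x) :
    ∃ X : Cₛ^∞⟮I; E, (TangentSpace I : M → Type _)⟯, X x = v := by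
  obtain ⟨X, hX⟩ := exists_smooth_field_eq_extend v
  exact ⟨X, by simpa using hX.self_of_nhds⟩

theorem contMDiff_mvfderiv_apply {f : M → ℝ} (hf : CMDiff ∞ f)
    (X : Cₛ^∞⟮I; E, (TangentSpace I : M → Type _)⟯) :
    CMDiff ∞ (fun y => d% f y (X y)) := by
  have h1 := (hf.contMDiff_tangentMap (m := ∞) (by rfl)).comp X.contMDiff
  exact (contMDiff_snd_tangentBundle_modelSpace ℝ 𝓘(ℝ, ℝ)).comp h1

variable (I M) in
theorem isManifold_minSmoothness : IsManifold I (minSmoothness ℝ 3) M :=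
  IsManifold.of_le (n := ∞) (by simpa using ENat.LEInfty.out)

theorem contMDiff_mlieBracket (X Y : Cₛ^∞⟮I; E, (TangentSpace I : M → Type _)⟯) :
    CMDiff ∞ (T% (mlieBracket I X Y)) := by
  have := isManifold_minSmoothness I M
  have : IsManifold I (((⊤ : ℕ∞) : WithTop ℕ∞) + 1) M := inferInstanceAs (IsManifold I ∞ M)
  exact ContDiff.mlieBracket_vectorField (n := ⊤) (m := ⊤) X.contMDiff Y.contMDiff (by simp)

variable (I) in
/-- Lie bracket of smooth vector fields. -/
def lie (X Y : Cₛ^∞⟮I; E, (TangentSpace I : M → Type _)⟯) :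
    Cₛ^∞⟮I; E, (TangentSpace I : M → Type _)⟯ :=
  ⟨mlieBracket I X Y, contMDiff_mlieBracket X Y⟩

/-- The smooth function obtained by differentiating `f` along `X`. -/
def dir (X : Cₛ^∞⟮I; E, (TangentSpace I : M → Type _)⟯) (f : C^∞⟮I, M; ℝ⟯) : C^∞⟮I, M; ℝ⟯ :=
  ⟨fun y => d% f y (X y), contMDiff_mvfderiv_apply f.contMDiff X⟩

theorem smooth_mdifferentiableAt (f : C^∞⟮I, M; ℝ⟯) (x : M) : MDiffAt f x :=
  f.contMDiff.mdifferentiable (by simp) x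

@[simp] theorem lie_apply (X Y : Cₛ^∞⟮I; E, (TangentSpace I : M → Type _)⟯) (x : M) :
    lie I X Y x = mlieBracket I X Y x := rfl

@[simp] theorem dir_apply (X : Cₛ^∞⟮I; E, (TangentSpace I : M → Type _)⟯) (f : C^∞⟮I, M; ℝ⟯)
    (x : M) : dir X f x = d% f x (X x) := rfl

theorem lie_swap (X Y : Cₛ^∞⟮I; E, (TangentSpace I : M → Type _)⟯) : lie I X Y = -lie I Y X := by
  ext x
  simpa using mlieBracket_swap_apply

theorem lie_jacobi (X Y Z : Cₛ^∞⟮I; E, (TangentSpace I : M → Type _)⟯) :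
    lie I X (lie I Y Z) = lie I (lie I X Y) Z + lie I Y (lie I X Z) := by
  have := isManifold_minSmoothness I M
  have h (W : Cₛ^∞⟮I; E, (TangentSpace I : M → Type _)⟯) : CMDiff (minSmoothness ℝ 2)
      (T% fun x => W x) :=
    W.contMDiff.of_le (by simpa using ENat.LEInfty.out)
  ext x
  exact congrFun (leibniz_identity_mlieBracket (h X) (h Y) (h Z)) x

/-- Multiplication of a smooth vector field by a smooth function. -/
def fsmul (f : C^∞⟮I, M; ℝ⟯) (X : Cₛ^∞⟮I; E, (TangentSpace I : M → Type _)⟯) :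
    Cₛ^∞⟮I; E, (TangentSpace I : M → Type _)⟯ :=
  ⟨(f : M → ℝ) • (X : Π x : M, TangentSpace I x), f.contMDiff.smul_section X.contMDiff⟩

@[simp] theorem fsmul_apply (f : C^∞⟮I, M; ℝ⟯) (X : Cₛ^∞⟮I; E, (TangentSpace I : M → Type _)⟯)
    (x : M) : fsmul f X x = f x • X x := rfl

theorem lie_fsmul (X Y : Cₛ^∞⟮I; E, (TangentSpace I : M → Type _)⟯) (f : C^∞⟮I, M; ℝ⟯) :
    lie I X (fsmul f Y) = fsmul (dir X f) Y + fsmul f (lie I X Y) := by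
  ext x
  exact mlieBracket_smul_right (smooth_mdifferentiableAt f x) Y.mdifferentiableAt

theorem lie_add_right (X Y Z : Cₛ^∞⟮I; E, (TangentSpace I : M → Type _)⟯) :
    lie I X (Y + Z) = lie I X Y + lie I X Z := by
  ext x
  exact mlieBracket_add_right Y.mdifferentiableAt Z.mdifferentiableAt

theorem dir_add (X : Cₛ^∞⟮I; E, (TangentSpace I : M → Type _)⟯) (f g : C^∞⟮I, M; ℝ⟯) :
    dir X (f + g) = dir X f + dir X g := by
  ext x
  have := mvfderiv_add (smooth_mdifferentiableAt f x) (smooth_mdifferentiableAt g x)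
  simp [this]

/-- The bracket acts on functions as the commutator of derivations. -/
theorem dir_lie [T2Space M] (X Y : Cₛ^∞⟮I; E, (TangentSpace I : M → Type _)⟯)
    (f : C^∞⟮I, M; ℝ⟯) : dir (lie I X Y) f = dir X (dir Y f) - dir Y (dir X f) := by
  ext x
  have key (W : Cₛ^∞⟮I; E, (TangentSpace I : M → Type _)⟯) :
      (dir X (dir Y f) x - dir Y (dir X f) x - dir (lie I X Y) f x) • W x = 0 := by
    have h := congr($(lie_jacobi X Y (fsmul f W)) x)
    have h' := congr($(lie_jacobi X Y W) x)
    simp only [lie_fsmul, lie_add_right, ContMDiffSection.coe_add, Pi.add_apply,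
      fsmul_apply] at h h'
    rw [h'] at h
    rw [← sub_eq_zero] at h
    rw [← h]
    module
  rw [ContMDiffMap.coe_sub, Pi.sub_apply]
  by_cases h0 : ∃ v : TangentSpace I x, v ≠ 0
  · obtain ⟨v, hv⟩ := h0
    obtain ⟨W, rfl⟩ := exists_smooth_field v
    have := (smul_eq_zero.1 (key W)).resolve_right hv
    linarith
  · push Not at h0
    simp [dir_apply, h0 (X x), h0 (Y x), h0 (mlieBracket I X Y x)]

end Fields

section Riemannian

variable {E : Type*} [NormedAddCommGroup E] [NormedSpace ℝ E] [FiniteDimensional ℝ E]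
  {H : Type*} [TopologicalSpace H] {I : ModelWithCorners ℝ E H}
  {M : Type*} [TopologicalSpace M] [ChartedSpace H M] [IsManifold I ∞ M]
  [RiemannianBundle (fun x : M => TangentSpace I x)]
  [IsContMDiffRiemannianBundle I ∞ E (fun x : M => TangentSpace I x)]

/-- The smooth function `⟨X, Y⟩`. -/
def ip (X Y : Cₛ^∞⟮I; E, (TangentSpace I : M → Type _)⟯) : C^∞⟮I, M; ℝ⟯ :=
  ⟨fun y => inner ℝ (X y) (Y y), ContMDiff.inner_bundle (IB := I) (F := E)
    (E := fun x : M => TangentSpace I x) X.contMDiff Y.contMDiff⟩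

@[simp] theorem ip_apply (X Y : Cₛ^∞⟮I; E, (TangentSpace I : M → Type _)⟯) (x : M) :
    ip X Y x = inner ℝ (X x) (Y x) := rfl

theorem ip_comm (X Y : Cₛ^∞⟮I; E, (TangentSpace I : M → Type _)⟯) : ip X Y = ip Y X := by
  ext x
  exact real_inner_comm (Y x) (X x)

/-- Rescaling to unit length near a point. -/
theorem exists_normalized_field [T2Space M] {x : M}
    (X : Cₛ^∞⟮I; E, (TangentSpace I : M → Type _)⟯) (hX : X x ≠ 0) :
    ∃ Y : Cₛ^∞⟮I; E, (TangentSpace I : M → Type _)⟯, ∀ᶠ y in 𝓝 x, Y y = ‖X y‖⁻¹ • X y ∧ X y ≠ 0 := by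
  have hne : ∀ᶠ y in 𝓝 x, ip X X y ≠ 0 :=
    (ip X X).contMDiff.continuous.continuousAt.eventually_ne (by simpa using hX)
  obtain ⟨Y, hY⟩ := exists_smooth_field_eventuallyEq (x := x)
    (σ := fun y => (√(ip X X y))⁻¹ • X y) (by
      filter_upwards [hne] with y hy
      have h1 : ContDiffAt ℝ ∞ (fun t : ℝ => (√t)⁻¹) (ip X X y) :=
        (Real.contDiffAt_sqrt hy).inv (by
          rw [Real.sqrt_ne_zero']; exact lt_of_le_of_ne (real_inner_self_nonneg (x := X y)) hy.symm)
      exact ContMDiffAt.smul_section (f := fun y => (√(ip X X y))⁻¹) (s := (X : Π x : M, TangentSpace I x))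
        (h1.contMDiffAt.comp y (ip X X).contMDiff.contMDiffAt) X.contMDiff.contMDiffAt)
  refine ⟨Y, ?_⟩
  filter_upwards [hY, hne] with y h1 h2
  refine ⟨?_, by simpa using h2⟩
  rw [h1, ip_apply, real_inner_self_eq_norm_sq, Real.sqrt_sq (norm_nonneg _)]

theorem exists_smooth_orthonormal_finset [T2Space M] {ι : Type*} [DecidableEq ι] (x : M)
    (v : ι → TangentSpace I x) (hv : Orthonormal ℝ v) (s : Finset ι) :
    ∃ e : ι → Cₛ^∞⟮I; E, (TangentSpace I : M → Type _)⟯, (∀ i ∈ s, e i x = v i) ∧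
      ∀ᶠ y in 𝓝 x, ∀ i ∈ s, ∀ j ∈ s, inner ℝ (e i y) (e j y) = if i = j then (1 : ℝ) else 0 := by
  induction s using Finset.induction_on with
  | empty => exact ⟨fun _ => 0, by simp⟩
  | insert a s ha ih =>
    obtain ⟨e, he, ho⟩ := ih
    obtain ⟨A, hA⟩ := exists_smooth_field (v a)
    let B := A - ∑ i ∈ s, fsmul (ip A (e i)) (e i)
    have hB (y : M) : B y = A y - ∑ i ∈ s, (inner ℝ (A y) (e i y) : ℝ) • e i y := by
      have : (⇑(∑ i ∈ s, fsmul (ip A (e i)) (e i)) : Π x : M, TangentSpace I x) =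
          ∑ i ∈ s, ⇑(fsmul (ip A (e i)) (e i)) :=
        map_sum (ContMDiffSection.coeAddHom I E ∞ (TangentSpace I : M → Type _)) _ s
      simp [B, this]
    have hBx : B x = v a := by
      rw [hB, hA, Finset.sum_eq_zero, sub_zero]
      intro i hi
      rw [he i hi, hv.2 (by rintro rfl; exact ha hi), zero_smul]
    obtain ⟨C, hC⟩ := exists_normalized_field B (x := x)
      (by rw [hBx]; exact hv.ne_zero a)
    refine ⟨Function.update e a C, ?_, ?_⟩
    · intro i hi
      rcases Finset.mem_insert.1 hi with rfl | his
      · simp [hC.self_of_nhds.1, hBx, hv.1]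
      · rw [Function.update_of_ne (by rintro rfl; exact ha his), he i his]
    · filter_upwards [ho, hC] with y hy hCy
      have horth (j) (hj : j ∈ s) : inner ℝ (C y) (e j y) = 0 := by
        have h0 : inner ℝ (B y) (e j y) = 0 := by
          rw [hB, inner_sub_left, sum_inner]
          simp_rw [inner_smul_left]
          rw [Finset.sum_eq_single_of_mem j hj, hy j hj j hj]
          · simp
          · intro i hi hij
            rw [hy i hi j hj]
            simp [hij]
        rw [hCy.1, inner_smul_left, h0, mul_zero]
      have hunit : inner ℝ (C y) (C y) = (1 : ℝ) := by
        rw [real_inner_self_eq_norm_sq, hCy.1, norm_smul, norm_inv, norm_norm,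
          inv_mul_cancel₀ (norm_ne_zero_iff.2 hCy.2), one_pow]
      intro i hi j hj
      rcases Finset.mem_insert.1 hi with hia | his <;> rcases Finset.mem_insert.1 hj with hja | hjs
      · subst hia hja
        simpa using hunit
      · subst hia
        have hne : j ≠ i := by rintro rfl; exact ha hjs
        simp [hne, hne.symm, horth j hjs]
      · subst hja
        have hne : i ≠ j := by rintro rfl; exact ha his
        rw [real_inner_comm]
        simp [hne, horth i his]
      · have hi' : i ≠ a := by rintro rfl; exact ha his
        have hj' : j ≠ a := by rintro rfl; exact ha hjs
        simp [hi', hj', hy i his j hjs]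

/-- An orthonormal basis of `T_x M` extends to smooth vector fields, orthonormal near `x`. -/
theorem exists_smooth_orthonormal [T2Space M] {ι : Type*} [Fintype ι] (x : M)
    (v : ι → TangentSpace I x) (hv : Orthonormal ℝ v) :
    ∃ e : ι → Cₛ^∞⟮I; E, (TangentSpace I : M → Type _)⟯, (∀ i, e i x = v i) ∧
      ∀ᶠ y in 𝓝 x, Orthonormal ℝ fun i => e i y := by
  classical
  obtain ⟨e, he, ho⟩ := exists_smooth_orthonormal_finset x v hv Finset.univ
  refine ⟨e, by simpa using he, ?_⟩
  filter_upwards [ho] with y hy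
  rw [orthonormal_iff_ite]
  simpa using hy

theorem exists_smooth_frame [T2Space M] (x : M) :
    ∃ e : Fin (Module.finrank ℝ E) → Cₛ^∞⟮I; E, (TangentSpace I : M → Type _)⟯,
      ∀ᶠ y in 𝓝 x, ∃ b : OrthonormalBasis (Fin (Module.finrank ℝ E)) ℝ (TangentSpace I y),
        ∀ i, b i = e i y := by
  let b₀ : OrthonormalBasis (Fin (Module.finrank ℝ E)) ℝ (TangentSpace I x) :=
    stdOrthonormalBasis ℝ (TangentSpace I x)
  obtain ⟨e, -, he⟩ := exists_smooth_orthonormal x b₀ b₀.orthonormal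
  refine ⟨e, ?_⟩
  filter_upwards [he] with y hy
  have hcard : Fintype.card (Fin (Module.finrank ℝ E)) = Module.finrank ℝ (TangentSpace I y) := by
    rw [Fintype.card_fin, finrank_tangentSpace]
  have hspan := hy.linearIndependent.span_eq_top_of_card_eq_finrank' hcard
  exact ⟨OrthonormalBasis.mk hy hspan.ge, fun i => by simp⟩

end Riemannian

theorem pair_symmetry {α : Type*} {Q : α → α → α → α → ℝ} (h1 : ∀ x y z w, Q x y z w = -Q y x z w)
    (h2 : ∀ x y z w, Q x y z w = -Q x y w z)
    (h3 : ∀ x y z w, Q x y z w + Q y z x w + Q z x y w = 0) (x y z w : α) :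
    Q x y z w = Q z w x y := by
  linarith [h3 x y z w, h3 y z w x, h3 z w x y, h3 w x y z, h1 x y z w, h1 y z x w, h1 z x y w,
    h1 y z w x, h1 z w y x, h1 w y z x, h1 z w x y, h1 w x z y, h1 x z w y, h1 w x y z, h1 x y w z,
    h1 y w x z, h2 x y z w, h2 y z x w, h2 z x y w, h2 y z w x, h2 z w x y, h2 w y z x, h2 w x z y,
    h2 x z w y, h2 z w y x, h2 w x y z, h2 y w x z, h2 x z y w, h2 y w z x]

section Connection

variable {E : Type*} [NormedAddCommGroup E] [NormedSpace ℝ E] [FiniteDimensional ℝ E]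
  {H : Type*} [TopologicalSpace H] {I : ModelWithCorners ℝ E H}
  {M : Type*} [TopologicalSpace M] [T2Space M] [ChartedSpace H M] [IsManifold I ∞ M]
  [RiemannianBundle (fun x : M => TangentSpace I x)]
  [IsContMDiffRiemannianBundle I ∞ E (fun x : M => TangentSpace I x)]

theorem contMDiff_leviCivita (X Y : Cₛ^∞⟮I; E, (TangentSpace I : M → Type _)⟯) :
    CMDiff ∞ (T% fun y => leviCivita I M Y y (X y)) := by
  intro x
  obtain ⟨e, he⟩ := exists_smooth_frame (I := I) x
  let c (Z : Cₛ^∞⟮I; E, (TangentSpace I : M → Type _)⟯) : C^∞⟮I, M; ℝ⟯ :=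
    dir X (ip Y Z) + dir Y (ip X Z) - dir Z (ip X Y) + ip (lie I X Y) Z - ip (lie I X Z) Y
      - ip (lie I Y Z) X
  have hc (Z : Cₛ^∞⟮I; E, (TangentSpace I : M → Type _)⟯) (y : M) :
      inner ℝ (leviCivita I M Y y (X y)) (Z y) = (1 / 2 : ℝ) * c Z y :=
    inner_leviCivitaFun I X.mdifferentiableAt Y.mdifferentiableAt Z.mdifferentiableAt
  have hsm : CMDiffAt ∞ (T% fun y => ∑ i, ((1 / 2 : ℝ) * c (e i) y) • e i y) x := by
    refine ContMDiffAt.sum_section fun i _ => ?_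
    exact ContMDiffAt.smul_section (f := fun y => (1 / 2 : ℝ) * c (e i) y)
      (s := (e i : Π x : M, TangentSpace I x))
      (contMDiffAt_const.mul (c (e i)).contMDiff.contMDiffAt) (e i).contMDiff.contMDiffAt
  refine hsm.congr_of_eventuallyEq ?_
  filter_upwards [he] with y ⟨b, hb⟩
  congr 1
  conv_lhs => rw [← b.sum_repr (leviCivita I M Y y (X y))]
  refine Finset.sum_congr rfl fun i _ => ?_
  rw [OrthonormalBasis.repr_apply_apply, real_inner_comm, hb, hc]

/-- The Levi-Civita connection on smooth vector fields. -/
def nabla (X Y : Cₛ^∞⟮I; E, (TangentSpace I : M → Type _)⟯) :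
    Cₛ^∞⟮I; E, (TangentSpace I : M → Type _)⟯ :=
  ⟨fun y => leviCivita I M Y y (X y), contMDiff_leviCivita X Y⟩

@[simp] theorem nabla_apply (X Y : Cₛ^∞⟮I; E, (TangentSpace I : M → Type _)⟯) (x : M) :
    nabla X Y x = leviCivita I M Y x (X x) := rfl

theorem nabla_add_left (X Y Z : Cₛ^∞⟮I; E, (TangentSpace I : M → Type _)⟯) :
    nabla (X + Y) Z = nabla X Z + nabla Y Z := by
  ext x
  simp

theorem nabla_add_right (X Y Z : Cₛ^∞⟮I; E, (TangentSpace I : M → Type _)⟯) :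
    nabla X (Y + Z) = nabla X Y + nabla X Z := by
  ext x
  have := (isCovariantDerivativeOn_leviCivitaFun (I := I) (M := M)).add
    (Y.mdifferentiableAt (x := x)) (Z.mdifferentiableAt (x := x))
  exact congr($this (X x))

/-- The additive endomorphism `∇_X`. -/
def nablaHom : Cₛ^∞⟮I; E, (TangentSpace I : M → Type _)⟯ →+
    Cₛ^∞⟮I; E, (TangentSpace I : M → Type _)⟯ →+ Cₛ^∞⟮I; E, (TangentSpace I : M → Type _)⟯ :=
  AddMonoidHom.mk' (fun X => AddMonoidHom.mk' (nabla X) (nabla_add_right X))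
    fun X Y => by ext1 Z; exact nabla_add_left X Y Z

theorem nabla_sub_left (X Y Z : Cₛ^∞⟮I; E, (TangentSpace I : M → Type _)⟯) :
    nabla (X - Y) Z = nabla X Z - nabla Y Z :=
  congr($(map_sub (nablaHom (I := I) (M := M)) X Y) Z)

theorem nabla_neg_left (X Z : Cₛ^∞⟮I; E, (TangentSpace I : M → Type _)⟯) :
    nabla (-X) Z = -nabla X Z :=
  congr($(map_neg (nablaHom (I := I) (M := M)) X) Z)

theorem nabla_sub_right (X Y Z : Cₛ^∞⟮I; E, (TangentSpace I : M → Type _)⟯) :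
    nabla X (Y - Z) = nabla X Y - nabla X Z :=
  map_sub (nablaHom X) Y Z

theorem nabla_torsion (X Y : Cₛ^∞⟮I; E, (TangentSpace I : M → Type _)⟯) :
    nabla X Y - nabla Y X = lie I X Y := by
  ext x
  exact ((leviCivita I M).torsion_eq_zero_iff).1 (leviCivita_torsion I) X.mdifferentiableAt
    Y.mdifferentiableAt

theorem dir_ip (X Y Z : Cₛ^∞⟮I; E, (TangentSpace I : M → Type _)⟯) :
    dir X (ip Y Z) = ip (nabla X Y) Z + ip Y (nabla X Z) := by
  ext x
  exact leviCivita_metric I X.mdifferentiableAt Y.mdifferentiableAt Z.mdifferentiableAt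

/-- The curvature operator on smooth vector fields. -/
def curv (X Y Z : Cₛ^∞⟮I; E, (TangentSpace I : M → Type _)⟯) :
    Cₛ^∞⟮I; E, (TangentSpace I : M → Type _)⟯ :=
  nabla X (nabla Y Z) - nabla Y (nabla X Z) - nabla (lie I X Y) Z

theorem curv_apply (X Y Z : Cₛ^∞⟮I; E, (TangentSpace I : M → Type _)⟯) (x : M) :
    curv X Y Z x = curvatureField I X Y Z x := rfl

theorem curv_swap (X Y Z : Cₛ^∞⟮I; E, (TangentSpace I : M → Type _)⟯) :
    curv X Y Z = -curv Y X Z := by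
  rw [curv, curv, lie_swap Y X, nabla_neg_left]
  abel

theorem ip_sub_left (X Y Z : Cₛ^∞⟮I; E, (TangentSpace I : M → Type _)⟯) :
    ip (X - Y) Z = ip X Z - ip Y Z := by
  ext x
  simp [inner_sub_left]

theorem ip_sub_right (X Y Z : Cₛ^∞⟮I; E, (TangentSpace I : M → Type _)⟯) :
    ip X (Y - Z) = ip X Y - ip X Z := by
  ext x
  simp [inner_sub_right]

theorem ip_curv_skew (X Y Z W : Cₛ^∞⟮I; E, (TangentSpace I : M → Type _)⟯) :
    ip (curv X Y Z) W = -ip (curv X Y W) Z := by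
  have h := dir_lie X Y (ip Z W)
  simp only [dir_ip, dir_add] at h
  rw [ip_comm (curv X Y W) Z]
  simp only [curv, ip_sub_left, ip_sub_right]
  linear_combination -h

theorem lie_jacobi_cyclic (X Y Z : Cₛ^∞⟮I; E, (TangentSpace I : M → Type _)⟯) :
    lie I X (lie I Y Z) + lie I Y (lie I Z X) + lie I Z (lie I X Y) = 0 := by
  have hJ := lie_jacobi X Y Z
  rw [lie_swap (lie I X Y) Z, lie_swap X Z] at hJ
  have hneg : lie I Y (-lie I Z X) = -lie I Y (lie I Z X) := by
    have : nabla Y (-lie I Z X) = -nabla Y (lie I Z X) := map_neg (nablaHom Y) _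
    rw [← nabla_torsion Y (-lie I Z X), ← nabla_torsion Y (lie I Z X), nabla_neg_left, this]
    abel
  rw [hneg] at hJ
  rw [hJ]
  abel

theorem curv_bianchi (X Y Z : Cₛ^∞⟮I; E, (TangentSpace I : M → Type _)⟯) :
    curv X Y Z + curv Y Z X + curv Z X Y = 0 := by
  have h (A B C : Cₛ^∞⟮I; E, (TangentSpace I : M → Type _)⟯) :
      nabla A (nabla B C) - nabla A (nabla C B) = nabla (lie I B C) A + lie I A (lie I B C) := by
    rw [← nabla_sub_right, nabla_torsion, ← nabla_torsion A]
    abel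
  calc curv X Y Z + curv Y Z X + curv Z X Y
      = (nabla X (nabla Y Z) - nabla X (nabla Z Y) - nabla (lie I Y Z) X)
        + (nabla Y (nabla Z X) - nabla Y (nabla X Z) - nabla (lie I Z X) Y)
        + (nabla Z (nabla X Y) - nabla Z (nabla Y X) - nabla (lie I X Y) Z) := by
        simp only [curv]; abel
    _ = lie I X (lie I Y Z) + lie I Y (lie I Z X) + lie I Z (lie I X Y) := by
        rw [h, h, h]; abel
    _ = 0 := lie_jacobi_cyclic X Y Z

theorem ip_curv_pair (X Y Z W : Cₛ^∞⟮I; E, (TangentSpace I : M → Type _)⟯) (x : M) :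
    inner ℝ (curv X Y Z x) (W x) = inner ℝ (curv Z W X x) (Y x) := by
  refine pair_symmetry (Q := fun X Y Z W => inner ℝ (curv X Y Z x) (W x)) ?_ ?_ ?_ X Y Z W
  · intro X Y Z W
    simp [curv_swap X Y Z, inner_neg_left]
  · intro X Y Z W
    exact congr($(ip_curv_skew X Y Z W) x)
  · intro X Y Z W
    rw [← inner_add_left, ← inner_add_left]
    have := congr($(curv_bianchi X Y Z) x)
    simp only [ContMDiffSection.coe_add, Pi.add_apply] at this
    rw [this]
    simp

theorem curv_congr_apply {X Y Z X' Y' Z' : Cₛ^∞⟮I; E, (TangentSpace I : M → Type _)⟯} {x : M}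
    (hX : X x = X' x) (hY : Y x = Y' x) (hZ : Z x = Z' x) : curv X Y Z x = curv X' Y' Z' x := by
  have hskew (X Y Z W : Cₛ^∞⟮I; E, (TangentSpace I : M → Type _)⟯) :
      inner ℝ (curv X Y Z x) (W x) = -inner ℝ (curv X Y W x) (Z x) :=
    congr($(ip_curv_skew X Y Z W) x)
  refine ext_inner_right ℝ fun w => ?_
  obtain ⟨W, rfl⟩ := exists_smooth_field w
  rw [hskew, hZ, ← hskew, ip_curv_pair, hY, hskew, hX, ← hskew, ← ip_curv_pair]

theorem curvature_eq (X Y Z : Cₛ^∞⟮I; E, (TangentSpace I : M → Type _)⟯) (x : M) :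
    curvature I x (X x) (Y x) (Z x) = curv X Y Z x := by
  obtain ⟨X', hX⟩ := exists_smooth_field_eq_extend (X x)
  obtain ⟨Y', hY⟩ := exists_smooth_field_eq_extend (Y x)
  obtain ⟨Z', hZ⟩ := exists_smooth_field_eq_extend (Z x)
  rw [curv_congr_apply (X' := X') (Y' := Y') (Z' := Z') (by simpa using hX.self_of_nhds.symm)
    (by simpa using hY.self_of_nhds.symm) (by simpa using hZ.self_of_nhds.symm), curv_apply,
    curvature, curvatureField, curvatureField]
  have hcov := isCovariantDerivativeOn_leviCivitaFun (I := I) (M := M)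
  have hsm {σ τ : Π x : M, TangentSpace I x} (hσ : MDiffAt (T% σ) x)
      (h : ∀ᶠ y in 𝓝 x, σ y = τ y) : leviCivita I M τ x = leviCivita I M σ x := by
    have hτ : MDiffAt (T% τ) x := by
      refine hσ.congr_of_eventuallyEq ?_
      filter_upwards [h] with y hy
      rw [hy]
    exact hcov.congr_of_eventuallyEq hτ hσ Filter.univ_mem (h.mono fun y hy => hy.symm)
  have hZ' : ∀ᶠ y in 𝓝 x, leviCivita I M (extend E (Z x)) y = leviCivita I M Z' y := by
    filter_upwards [eventually_eventually_nhds.2 hZ, eventually_contMDiffAt_extend (Z x)]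
      with y hy hs
    exact hcov.congr_of_eventuallyEq (hs.mdifferentiableAt (by simp)) Z'.mdifferentiableAt
      Filter.univ_mem (hy.mono fun y hy => hy.symm)
  have hbr : mlieBracket I (extend E (X x)) (extend E (Y x)) x = mlieBracket I X' Y' x :=
    Filter.EventuallyEq.mlieBracket_vectorField_eq (hX.mono fun y hy => hy.symm)
      (hY.mono fun y hy => hy.symm)
  have h1 := hsm (nabla Y' Z').mdifferentiableAt
    (τ := fun y => leviCivita I M (extend E (Z x)) y (extend E (Y x) y)) (by
      filter_upwards [hY, hZ'] with y h1 h2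
      rw [nabla_apply, h1, h2])
  have h2 := hsm (nabla X' Z').mdifferentiableAt
    (τ := fun y => leviCivita I M (extend E (Z x)) y (extend E (X x) y)) (by
      filter_upwards [hX, hZ'] with y h1 h2
      rw [nabla_apply, h1, h2])
  rw [hbr, hZ'.self_of_nhds, ← hX.self_of_nhds, ← hY.self_of_nhds, h1, h2]
  rfl

/-- The covariant derivative `(∇_X R)(Y, Z) W` of the curvature. -/
def nablaCurv (X Y Z W : Cₛ^∞⟮I; E, (TangentSpace I : M → Type _)⟯) :
    Cₛ^∞⟮I; E, (TangentSpace I : M → Type _)⟯ :=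
  nabla X (curv Y Z W) - curv (nabla X Y) Z W - curv Y (nabla X Z) W - curv Y Z (nabla X W)

theorem curv_add_left (X X' Y Z : Cₛ^∞⟮I; E, (TangentSpace I : M → Type _)⟯) :
    curv (X + X') Y Z = curv X Y Z + curv X' Y Z := by
  simp only [curv, nabla_add_left, nabla_add_right, ← nabla_torsion, nabla_sub_left]
  abel

theorem curv_sub_left (X X' Y Z : Cₛ^∞⟮I; E, (TangentSpace I : M → Type _)⟯) :
    curv (X - X') Y Z = curv X Y Z - curv X' Y Z := by
  rw [eq_sub_iff_add_eq, ← curv_add_left, sub_add_cancel]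

theorem second_bianchi (X Y Z W : Cₛ^∞⟮I; E, (TangentSpace I : M → Type _)⟯) :
    nablaCurv X Y Z W + nablaCurv Y Z X W + nablaCurv Z X Y W = 0 := by
  have hswap (A B C : Cₛ^∞⟮I; E, (TangentSpace I : M → Type _)⟯) :
      curv A (nabla B C) W = -curv (nabla B C) A W := curv_swap _ _ _
  have hcomm (A B C : Cₛ^∞⟮I; E, (TangentSpace I : M → Type _)⟯) :
      nabla A (curv B C W) - curv B C (nabla A W) =
        nabla A (nabla B (nabla C W)) - nabla A (nabla C (nabla B W))
          - nabla B (nabla C (nabla A W)) + nabla C (nabla B (nabla A W))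
          - curv A (lie I B C) W - nabla (lie I A (lie I B C)) W := by
    simp only [curv, nabla_sub_right]
    abel
  have hlie (A B C : Cₛ^∞⟮I; E, (TangentSpace I : M → Type _)⟯) :
      curv A (lie I B C) W = -curv (nabla B C) A W + curv (nabla C B) A W := by
    rw [curv_swap, ← nabla_torsion, curv_sub_left]
    abel
  have hJ' : nabla (lie I X (lie I Y Z)) W + nabla (lie I Y (lie I Z X)) W
      + nabla (lie I Z (lie I X Y)) W = 0 := by
    rw [← nabla_add_left, ← nabla_add_left, lie_jacobi_cyclic]
    exact map_zero (nablaHom.flip W)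
  calc _ = (nabla X (curv Y Z W) - curv Y Z (nabla X W))
        + (nabla Y (curv Z X W) - curv Z X (nabla Y W))
        + (nabla Z (curv X Y W) - curv X Y (nabla Z W))
        - curv (nabla X Y) Z W - curv Y (nabla X Z) W
        - curv (nabla Y Z) X W - curv Z (nabla Y X) W
        - curv (nabla Z X) Y W - curv X (nabla Z Y) W := by
        simp only [nablaCurv]; abel
    _ = -(nabla (lie I X (lie I Y Z)) W + nabla (lie I Y (lie I Z X)) W
      + nabla (lie I Z (lie I X Y)) W) := by
        rw [hcomm, hcomm, hcomm, hlie, hlie, hlie, hswap, hswap, hswap]; abel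
    _ = 0 := by rw [hJ', neg_zero]

end Connection

section Pointwise

variable {V : Type*} [NormedAddCommGroup V] [InnerProductSpace ℝ V]

/-- The algebraic symmetries of a curvature tensor, except for multilinearity, which follows. -/
structure IsCurvatureLike (R : V → V → V → V) : Prop where
  swap : ∀ u v w, R u v w = -R v u w
  skew : ∀ u v w z, inner ℝ (R u v w) z = -inner ℝ (R u v z) w
  bianchi : ∀ u v w, R u v w + R v w u + R w u v = 0

namespace IsCurvatureLike

variable {R : V → V → V → V} (h : IsCurvatureLike R)
include h

theorem inner_swap (u v w z : V) : inner ℝ (R u v w) z = -inner ℝ (R v u w) z := by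
  rw [h.swap, inner_neg_left]

theorem pair (u v w z : V) : inner ℝ (R u v w) z = inner ℝ (R w z u) v :=
  pair_symmetry (Q := fun u v w z => inner ℝ (R u v w) z) h.inner_swap h.skew
    (fun u v w z => by simp only [← inner_add_left, h.bianchi, inner_zero_left]) u v w z

theorem add₃ (u v w w' : V) : R u v (w + w') = R u v w + R u v w' := by
  refine ext_inner_right ℝ fun z => ?_
  rw [h.skew, inner_add_right, inner_add_left, h.skew u v w, h.skew u v w']
  ring

theorem smul₃ (c : ℝ) (u v w : V) : R u v (c • w) = c • R u v w := by
  refine ext_inner_right ℝ fun z => ?_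
  rw [h.skew, inner_smul_right, inner_smul_left, h.skew u v w]
  simp

theorem add₂ (u v v' w : V) : R u (v + v') w = R u v w + R u v' w := by
  refine ext_inner_right ℝ fun z => ?_
  rw [h.pair, inner_add_right, inner_add_left, h.pair u v, h.pair u v']

theorem smul₂ (c : ℝ) (u v w : V) : R u (c • v) w = c • R u v w := by
  refine ext_inner_right ℝ fun z => ?_
  rw [h.pair, inner_smul_right, inner_smul_left, h.pair u v]
  simp

theorem add₁ (u u' v w : V) : R (u + u') v w = R u v w + R u' v w := by
  rw [h.swap, h.add₂, h.swap u, h.swap u', neg_add]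

theorem smul₁ (c : ℝ) (u v w : V) : R (c • u) v w = c • R u v w := by
  rw [h.swap, h.smul₂, h.swap u, smul_neg]

theorem self₁₂ (u w : V) : R u u w = 0 := by
  have h0 : (2 : ℝ) • R u u w = 0 := by
    rw [two_smul]
    nth_rw 2 [h.swap]
    exact add_neg_cancel _
  exact (smul_eq_zero.1 h0).resolve_left two_ne_zero

theorem self₃₄ (u v w : V) : inner ℝ (R u v w) w = 0 := by
  have := h.skew u v w w
  linarith

end IsCurvatureLike

theorem eq_zero_of_sum_subsets_eq_zero {α : Type*} [DecidableEq α] {s : Finset α} {f : α → ℝ}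
    {k : ℕ} (hk : 1 ≤ k) (hks : k < s.card)
    (hf : ∀ T ⊆ s, T.card = k → ∑ i ∈ T, f i = 0) {i : α} (hi : i ∈ s) : f i = 0 := by
  have heq : ∀ j ∈ s, f j = f i := by
    intro j hj
    rcases eq_or_ne j i with rfl | hji
    · rfl
    have hc : k - 1 ≤ ((s.erase i).erase j).card := by
      rw [Finset.card_erase_of_mem (Finset.mem_erase.2 ⟨hji, hj⟩), Finset.card_erase_of_mem hi]
      omega
    obtain ⟨T, hT, hTk⟩ := Finset.exists_subset_card_eq hc
    have hiT : i ∉ T := fun h => by simpa using hT h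
    have hjT : j ∉ T := fun h => by simpa using hT h
    have hTs : T ⊆ s := hT.trans ((Finset.erase_subset _ _).trans (Finset.erase_subset _ _))
    have h1 := hf (insert i T) (Finset.insert_subset hi hTs)
      (by rw [Finset.card_insert_of_notMem hiT]; omega)
    have h2 := hf (insert j T) (Finset.insert_subset hj hTs)
      (by rw [Finset.card_insert_of_notMem hjT]; omega)
    rw [Finset.sum_insert hiT] at h1
    rw [Finset.sum_insert hjT] at h2
    linarith
  obtain ⟨T, hT, hTk⟩ := Finset.exists_subset_card_eq hks.le
  have h := hf T hT hTk
  rw [Finset.sum_congr rfl fun j hj => heq j (hT hj), Finset.sum_const, hTk, nsmul_eq_mul,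
    mul_eq_zero] at h
  refine h.resolve_left ?_
  exact_mod_cast (by omega : k ≠ 0)

/-- `R` satisfies the condition for special submanifolds on orthonormal sets of `r` vectors. -/
def SpecialOn (R : V → V → V → V) (r : ℕ) : Prop :=
  ∀ T : Finset V, Orthonormal ℝ ((↑) : T → V) → T.card = r → ∀ w ∈ T, ∀ z,
    (∀ v ∈ T, inner ℝ v z = 0) → ∑ v ∈ T, inner ℝ (R v w v) z = 0

/-- `R u v u` has no component orthogonal to orthogonal vectors `u`, `v`. -/
def PreservesPlanes (R : V → V → V → V) : Prop :=
  ∀ u v n : V, inner ℝ u v = 0 → inner ℝ u n = 0 → inner ℝ v n = 0 → inner ℝ (R u v u) n = 0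

theorem inner_normalize {u v : V} (h : inner ℝ u v = 0) (a b : ℝ) :
    inner ℝ (a • u) (b • v) = 0 := by
  simp [inner_smul_left, inner_smul_right, h]

theorem inner_normalize_self {u : V} (h : u ≠ 0) :
    inner ℝ (‖u‖⁻¹ • u) (‖u‖⁻¹ • u) = (1 : ℝ) := by
  have : ‖u‖ ≠ 0 := norm_ne_zero_iff.2 h
  rw [inner_smul_left, inner_smul_right, real_inner_self_eq_norm_sq, conj_trivial]
  field_simp

theorem ne_of_inner_eq_zero {u v : V} (h : inner ℝ u v = 0) (hu : inner ℝ u u = (1 : ℝ)) :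
    u ≠ v := by
  rintro rfl
  linarith

section FiniteDimensional

variable [FiniteDimensional ℝ V]

/-- The trace defining the Ricci form. -/
def ric (R : V → V → V → V) (u w : V) : ℝ :=
  ∑ i, inner ℝ (R (stdOrthonormalBasis ℝ V i) u w) (stdOrthonormalBasis ℝ V i)

/-- A finite set of pairwise orthogonal unit vectors. -/
def IsOrthonormalSet (B : Finset V) : Prop :=
  (∀ v ∈ B, inner ℝ v v = (1 : ℝ)) ∧ ∀ v ∈ B, ∀ w ∈ B, v ≠ w → inner ℝ v w = (0 : ℝ)

theorem isOrthonormalSet_iff {B : Finset V} :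
    IsOrthonormalSet B ↔ Orthonormal ℝ ((↑) : B → V) := by
  classical
  refine Iff.trans ?_ (orthonormal_subtype_iff_ite (s := (B : Set V))).symm
  constructor
  · intro h v hv w hw
    split_ifs with hvw
    · exact hvw ▸ h.1 v hv
    · exact h.2 v hv w hw hvw
  · intro h
    exact ⟨fun v hv => by rw [h v hv v hv, if_pos rfl],
      fun v hv w hw hvw => by rw [h v hv w hw, if_neg hvw]⟩

theorem IsOrthonormalSet.mono {B T : Finset V} (h : IsOrthonormalSet B) (hT : T ⊆ B) :
    Orthonormal ℝ ((↑) : T → V) :=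
  isOrthonormalSet_iff.1
    ⟨fun v hv => h.1 v (hT hv), fun v hv w hw => h.2 v (hT hv) w (hT hw)⟩

theorem IsOrthonormalSet.exists_basis {s : Finset V} (hs : IsOrthonormalSet s) :
    ∃ (B : Finset V) (b : OrthonormalBasis B ℝ V), s ⊆ B ∧ (∀ i, b i = i) ∧
      B.card = Module.finrank ℝ V ∧ IsOrthonormalSet B := by
  have : Orthonormal ℝ (Subtype.val : ↥(s : Set V) → V) := isOrthonormalSet_iff.1 hs
  obtain ⟨B, b, hB, hb⟩ := this.exists_orthonormalBasis_extension
  refine ⟨B, b, by simpa using hB, fun i => congrFun hb i, ?_, ?_⟩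
  · rw [Module.finrank_eq_card_basis b.toBasis, Fintype.card_coe]
  · rw [isOrthonormalSet_iff, ← hb]
    exact b.orthonormal

theorem exists_finset_basis_pair {u v : V} (hu : inner ℝ u u = (1 : ℝ)) (hv : inner ℝ v v = (1 : ℝ))
    (huv : inner ℝ u v = 0) :
    ∃ (B : Finset V) (b : OrthonormalBasis B ℝ V), u ∈ B ∧ v ∈ B ∧ (∀ i, b i = i) ∧
      B.card = Module.finrank ℝ V ∧ IsOrthonormalSet B := by
  classical
  have hvu : inner ℝ v u = 0 := by rwa [real_inner_comm]
  have hs : IsOrthonormalSet {u, v} := by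
    simp only [IsOrthonormalSet, Finset.mem_insert, Finset.mem_singleton, forall_eq_or_imp,
      forall_eq]
    tauto
  obtain ⟨B, b, hB, h⟩ := hs.exists_basis
  exact ⟨B, b, hB (by simp), hB (by simp), h⟩

theorem exists_finset_basis_triple {u v w : V} (hu : inner ℝ u u = (1 : ℝ))
    (hv : inner ℝ v v = (1 : ℝ)) (hw : inner ℝ w w = (1 : ℝ)) (huv : inner ℝ u v = 0)
    (huw : inner ℝ u w = 0) (hvw : inner ℝ v w = 0) :
    ∃ (B : Finset V) (b : OrthonormalBasis B ℝ V), u ∈ B ∧ v ∈ B ∧ w ∈ B ∧ (∀ i, b i = i) ∧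
      B.card = Module.finrank ℝ V ∧ IsOrthonormalSet B := by
  classical
  have hvu : inner ℝ v u = 0 := by rwa [real_inner_comm]
  have hwu : inner ℝ w u = 0 := by rwa [real_inner_comm]
  have hwv : inner ℝ w v = 0 := by rwa [real_inner_comm]
  have hs : IsOrthonormalSet {u, v, w} := by
    simp only [IsOrthonormalSet, Finset.mem_insert, Finset.mem_singleton, forall_eq_or_imp,
      forall_eq]
    tauto
  obtain ⟨B, b, hB, h⟩ := hs.exists_basis
  exact ⟨B, b, hB (by simp), hB (by simp), hB (by simp), h⟩

namespace IsCurvatureLike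

variable {R : V → V → V → V} (h : IsCurvatureLike R)
include h

theorem ric_eq_sum {ι : Type*} [Fintype ι] (b : OrthonormalBasis ι ℝ V) (u w : V) :
    ric R u w = ∑ i, inner ℝ (R (b i) u w) (b i) := by
  let L : V →ₗ[ℝ] V :=
    { toFun := fun v => R v u w
      map_add' := fun v v' => h.add₁ v v' u w
      map_smul' := fun c v => h.smul₁ c v u w }
  have key : L.trace ℝ V = ric R u w := by
    rw [LinearMap.trace_eq_sum_inner L (stdOrthonormalBasis ℝ V)]
    exact Finset.sum_congr rfl fun i _ => real_inner_comm _ _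
  rw [← key, LinearMap.trace_eq_sum_inner L b]
  exact Finset.sum_congr rfl fun i _ => real_inner_comm _ _

theorem ric_eq_sum_finset {B : Finset V} (b : OrthonormalBasis B ℝ V) (hb : ∀ i, b i = i)
    (u w : V) : ric R u w = ∑ e ∈ B, inner ℝ (R e u w) e := by
  rw [h.ric_eq_sum b, ← Finset.sum_coe_sort B]
  exact Finset.sum_congr rfl fun i _ => by rw [hb]

theorem ric_symm (u w : V) : ric R u w = ric R w u :=
  Finset.sum_congr rfl fun i _ => by rw [h.pair, h.inner_swap, h.skew, neg_neg]

theorem ric_add_right (u w w' : V) : ric R u (w + w') = ric R u w + ric R u w' := by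
  simp [ric, h.add₃, inner_add_left, Finset.sum_add_distrib]

theorem ric_smul_right (c : ℝ) (u w : V) : ric R u (c • w) = c * ric R u w := by
  simp [ric, h.smul₃, inner_smul_left, Finset.mul_sum]

theorem ric_smul_left (c : ℝ) (u w : V) : ric R (c • u) w = c * ric R u w := by
  rw [h.ric_symm, h.ric_smul_right, h.ric_symm]

theorem ric_zero_right (u : V) : ric R u 0 = 0 := by
  simpa using h.ric_smul_right 0 u 0

theorem ric_zero_left (u : V) : ric R 0 u = 0 := by
  rw [h.ric_symm, h.ric_zero_right]

theorem ric_sub_right (u w w' : V) : ric R u (w - w') = ric R u w - ric R u w' := by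
  rw [eq_sub_iff_add_eq, ← h.ric_add_right, sub_add_cancel]

theorem exists_ric_eq (h0 : ∀ w n, inner ℝ w n = 0 → ric R w n = 0) :
    ∃ ρ : ℝ, ∀ u w, ric R u w = ρ * inner ℝ u w := by
  have hdiag (u w : V) (hn : ‖u‖ = ‖w‖) : ric R u u = ric R w w := by
    have := h0 (u + w) (u - w) (by
      rw [inner_add_left, inner_sub_right, inner_sub_right, real_inner_comm u w,
        real_inner_self_eq_norm_sq, real_inner_self_eq_norm_sq, hn]
      ring)
    rw [h.ric_sub_right, h.ric_symm (u + w), h.ric_symm (u + w), h.ric_add_right,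
      h.ric_add_right, h.ric_symm w u] at this
    linarith
  by_cases hV : ∃ e : V, e ≠ 0
  · obtain ⟨e, he⟩ := hV
    have he' : ‖e‖ ≠ 0 := norm_ne_zero_iff.2 he
    have hself (u : V) : ric R u u = ric R e e / ‖e‖ ^ 2 * ‖u‖ ^ 2 := by
      rw [hdiag u ((‖u‖ / ‖e‖) • e) (by rw [norm_smul, norm_div, norm_norm, norm_norm]; field_simp),
        h.ric_smul_right, h.ric_smul_left]
      field_simp
    refine ⟨ric R e e / ‖e‖ ^ 2, fun u w => ?_⟩
    rcases eq_or_ne u 0 with rfl | hu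
    · rw [h.ric_zero_left, inner_zero_left, mul_zero]
    have hu' : ‖u‖ ≠ 0 := norm_ne_zero_iff.2 hu
    have := h0 u (w - (inner ℝ u w / ‖u‖ ^ 2) • u) (by
      rw [inner_sub_right, inner_smul_right, real_inner_self_eq_norm_sq]
      field_simp
      ring)
    rw [h.ric_sub_right, h.ric_smul_right, hself] at this
    field_simp at this ⊢
    linarith
  · push Not at hV
    exact ⟨0, fun u w => by rw [hV u, h.ric_zero_left]; simp⟩

theorem ric_eq_zero_of_special {r : ℕ} (hr : r + 1 = Module.finrank ℝ V) (hs : SpecialOn R r)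
    (w n : V) (hwn : inner ℝ w n = 0) : ric R w n = 0 := by
  classical
  have unit (w n : V) (hw : inner ℝ w w = (1 : ℝ)) (hn : inner ℝ n n = (1 : ℝ))
      (hwn : inner ℝ w n = 0) : ric R w n = 0 := by
    obtain ⟨B, b, hwB, hnB, hb, hcard, ho⟩ := exists_finset_basis_pair hw hn hwn
    have := hs (B.erase n) (ho.mono (Finset.erase_subset _ _))
      (by rw [Finset.card_erase_of_mem hnB]; omega) w
      (Finset.mem_erase.2 ⟨ne_of_inner_eq_zero hwn hw, hwB⟩) n
      (fun v hv => ho.2 v (Finset.mem_of_mem_erase hv) n hnB (Finset.ne_of_mem_erase hv))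
    rw [h.ric_eq_sum_finset b hb, ← Finset.add_sum_erase _ _ hnB, h.self₃₄, zero_add,
      Finset.sum_congr rfl fun v _ => h.skew v w n v, Finset.sum_neg_distrib, this, neg_zero]
  rcases eq_or_ne w 0 with rfl | hw
  · exact h.ric_zero_left n
  rcases eq_or_ne n 0 with rfl | hn
  · exact h.ric_zero_right w
  have := unit _ _ (inner_normalize_self hw) (inner_normalize_self hn)
    (inner_normalize hwn ‖w‖⁻¹ ‖n‖⁻¹)
  rw [h.ric_smul_left, h.ric_smul_right] at this
  simpa [hw, hn] using this

theorem preservesPlanes_of_unit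
    (unit : ∀ u v n : V, inner ℝ u u = (1 : ℝ) → inner ℝ v v = (1 : ℝ) → inner ℝ n n = (1 : ℝ) →
      inner ℝ u v = 0 → inner ℝ u n = 0 → inner ℝ v n = 0 → inner ℝ (R u v u) n = 0) :
    PreservesPlanes R := by
  intro u v n huv hun hvn
  rcases eq_or_ne u 0 with rfl | hu
  · have := h.smul₃ 0 0 v 0
    simp only [zero_smul] at this
    rw [this, inner_zero_left]
  rcases eq_or_ne v 0 with rfl | hv
  · have := h.smul₂ 0 u 0 u
    simp only [zero_smul] at this
    rw [this, inner_zero_left]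
  rcases eq_or_ne n 0 with rfl | hn
  · exact inner_zero_right _
  have := unit _ _ _ (inner_normalize_self hu) (inner_normalize_self hv) (inner_normalize_self hn)
    (inner_normalize huv _ _) (inner_normalize hun _ _) (inner_normalize hvn _ _)
  simpa [h.smul₁, h.smul₂, h.smul₃, inner_smul_left, inner_smul_right, hu, hv, hn] using this

theorem preservesPlanes_of_special {r : ℕ} (hr2 : 2 ≤ r) (hr : r + 2 ≤ Module.finrank ℝ V)
    (hs : SpecialOn R r) : PreservesPlanes R := by
  classical
  refine h.preservesPlanes_of_unit fun u v n hu hv hn huv hun hvn => ?_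
  obtain ⟨B, b, huB, hvB, hnB, hb, hcard, ho⟩ := exists_finset_basis_triple hu hv hn huv hun hvn
  have hvn' := ne_of_inner_eq_zero hvn hv
  refine eq_zero_of_sum_subsets_eq_zero (s := (B.erase n).erase v) (k := r - 1)
    (f := fun u => inner ℝ (R u v u) n) (by omega) ?_ ?_ ?_
  · rw [Finset.card_erase_of_mem (Finset.mem_erase.2 ⟨hvn', hvB⟩), Finset.card_erase_of_mem hnB]
    omega
  · intro T hT hTc
    have hvT : v ∉ T := fun h => by simpa using hT h
    have hnT : n ∉ insert v T := by
      rw [Finset.mem_insert, not_or]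
      exact ⟨hvn'.symm, fun h => by simpa using hT h⟩
    have hTB : insert v T ⊆ B :=
      Finset.insert_subset hvB
        (hT.trans ((Finset.erase_subset _ _).trans (Finset.erase_subset _ _)))
    have := hs (insert v T) (ho.mono hTB)
      (by rw [Finset.card_insert_of_notMem hvT]; omega) v (Finset.mem_insert_self _ _) n
      (fun x hx => ho.2 x (hTB hx) n hnB (by rintro rfl; exact hnT hx))
    rwa [Finset.sum_insert hvT, h.self₁₂, inner_zero_left, zero_add] at this
  · exact Finset.mem_erase.2 ⟨ne_of_inner_eq_zero huv hu,
      Finset.mem_erase.2 ⟨ne_of_inner_eq_zero hun hu, huB⟩⟩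

theorem ric_eq_zero_of_preservesPlanes (hp : PreservesPlanes R) (w n : V)
    (hwn : inner ℝ w n = 0) : ric R w n = 0 := by
  classical
  have unit (w n : V) (hw : inner ℝ w w = (1 : ℝ)) (hn : inner ℝ n n = (1 : ℝ))
      (hwn : inner ℝ w n = 0) : ric R w n = 0 := by
    obtain ⟨B, b, hwB, hnB, hb, hcard, ho⟩ := exists_finset_basis_pair hw hn hwn
    rw [h.ric_eq_sum_finset b hb]
    refine Finset.sum_eq_zero fun e he => ?_
    rcases eq_or_ne e w with rfl | hew
    · rw [h.self₁₂, inner_zero_left]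
    rcases eq_or_ne e n with rfl | hen
    · exact h.self₃₄ _ _ _
    rw [h.skew, hp e w n (ho.2 e he w hwB hew) (ho.2 e he n hnB hen) hwn,
      neg_zero]
  rcases eq_or_ne w 0 with rfl | hw
  · exact h.ric_zero_left n
  rcases eq_or_ne n 0 with rfl | hn
  · exact h.ric_zero_right w
  have := unit _ _ (inner_normalize_self hw) (inner_normalize_self hn)
    (inner_normalize hwn ‖w‖⁻¹ ‖n‖⁻¹)
  rw [h.ric_smul_left, h.ric_smul_right] at this
  simpa [hw, hn] using this

end IsCurvatureLike

end FiniteDimensional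

/-- The Gram determinant of `u`, `v` in terms of the component of `v` orthogonal to `u`. -/
theorem gram_eq {u : V} (hu : u ≠ 0) (v : V) :
    inner ℝ u (v - (inner ℝ u v / ‖u‖ ^ 2) • u) = 0 ∧
      ‖u‖ ^ 2 * ‖v‖ ^ 2 - (inner ℝ u v) ^ 2 =
        ‖u‖ ^ 2 * ‖v - (inner ℝ u v / ‖u‖ ^ 2) • u‖ ^ 2 := by
  have hu' : ‖u‖ ≠ 0 := norm_ne_zero_iff.2 hu
  constructor
  · rw [inner_sub_right, inner_smul_right, real_inner_self_eq_norm_sq]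
    field_simp
    ring
  · rw [norm_sub_sq_real, inner_smul_right, norm_smul, real_inner_comm u v, Real.norm_eq_abs,
      mul_pow, sq_abs]
    field_simp
    ring

theorem ne_zero_of_linearIndependent_pair {u v : V} (huv : LinearIndependent ℝ ![u, v]) (c : ℝ) :
    u ≠ 0 ∧ v - c • u ≠ 0 := by
  rw [LinearIndependent.pair_iff] at huv
  constructor
  · rintro rfl
    simpa using huv 1 0 (by simp)
  · intro hv
    have := huv (-c) 1 (by rw [← hv]; module)
    simp at this

namespace IsCurvatureLike

variable {R : V → V → V → V} (h : IsCurvatureLike R)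
include h

theorem quad_sub_smul (u v : V) (c : ℝ) :
    inner ℝ (R u (v - c • u) (v - c • u)) u = inner ℝ (R u v v) u := by
  have h1 : R u (v - c • u) (v - c • u) = R u v v - c • R u v u := by
    rw [sub_eq_add_neg, ← neg_smul, h.add₂, h.smul₂, h.self₁₂, h.add₃, h.smul₃]
    module
  rw [h1, inner_sub_left, inner_smul_left, h.self₃₄]
  simp

theorem sectional_eq_of_ric [FiniteDimensional ℝ V] (hp : PreservesPlanes R)
    (hm : 2 ≤ Module.finrank ℝ V) {ρ : ℝ} (hρ : ∀ u w, ric R u w = ρ * inner ℝ u w) {u v : V}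
    (huv : LinearIndependent ℝ ![u, v]) :
    inner ℝ (R u v v) u / (‖u‖ ^ 2 * ‖v‖ ^ 2 - (inner ℝ u v) ^ 2) =
      ρ / (Module.finrank ℝ V - 1) := by
  classical
  have unit (u v : V) (hu : inner ℝ u u = (1 : ℝ)) (hv : inner ℝ v v = (1 : ℝ))
      (huv : inner ℝ u v = 0) : (Module.finrank ℝ V - 1) * inner ℝ (R u v v) u = ρ := by
    obtain ⟨B, b, huB, hvB, hb, hcard, ho⟩ := exists_finset_basis_pair hu hv huv
    have hsum := hρ v v
    rw [hv, mul_one, h.ric_eq_sum_finset b hb, ← Finset.add_sum_erase _ _ hvB, h.self₁₂,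
      inner_zero_left, zero_add, Finset.sum_congr rfl (g := fun _ => inner ℝ (R u v v) u),
      Finset.sum_const, Finset.card_erase_of_mem hvB, hcard, nsmul_eq_mul,
      Nat.cast_sub (by omega), Nat.cast_one] at hsum
    · exact hsum
    · intro e he
      obtain ⟨hev, heB⟩ := Finset.mem_erase.1 he
      rcases eq_or_ne e u with rfl | heu
      · rfl
      have hve : inner ℝ v e = 0 := ho.2 v hvB e heB hev.symm
      have hvu : inner ℝ v u = 0 := by rwa [real_inner_comm]
      have hue : inner ℝ u e = 0 := ho.2 u huB e heB heu.symm
      have heu : inner ℝ e u = 0 := by rwa [real_inner_comm]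
      have hee : inner ℝ e e = (1 : ℝ) := ho.1 e heB
      have h1 := hp v (u + e) (u - e) (by rw [inner_add_right, hvu, hve, add_zero])
        (by rw [inner_sub_right, hvu, hve, sub_zero])
        (by rw [inner_add_left, inner_sub_right, inner_sub_right, hu, hue, heu, hee]; ring)
      have h2 := hp v u e hvu hve hue
      have h3 := hp v e u hve hvu heu
      rw [h.add₂, inner_add_left, inner_sub_right, inner_sub_right] at h1
      rw [h.inner_swap e v v e, h.inner_swap u v v u]
      linarith
  obtain ⟨hu, hv'⟩ := ne_zero_of_linearIndependent_pair huv (inner ℝ u v / ‖u‖ ^ 2)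
  obtain ⟨horth, hgram⟩ := gram_eq hu v
  rw [hgram, ← h.quad_sub_smul u v (inner ℝ u v / ‖u‖ ^ 2)]
  generalize v - (inner ℝ u v / ‖u‖ ^ 2) • u = v' at *
  have := unit _ _ (inner_normalize_self hu) (inner_normalize_self hv')
    (inner_normalize horth ‖u‖⁻¹ ‖v'‖⁻¹)
  have hu0 : ‖u‖ ≠ 0 := norm_ne_zero_iff.2 hu
  have hv0 : ‖v'‖ ≠ 0 := norm_ne_zero_iff.2 hv'
  have hm0 : (Module.finrank ℝ V : ℝ) - 1 ≠ 0 := by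
    have : (2 : ℝ) ≤ Module.finrank ℝ V := by exact_mod_cast hm
    linarith
  simp only [h.smul₁, h.smul₂, h.smul₃, inner_smul_left, inner_smul_right, conj_trivial] at this
  rw [← this]
  field_simp

theorem inner_eq_zero_of_sectional {k : ℝ}
    (hk : ∀ u v : V, LinearIndependent ℝ ![u, v] →
      inner ℝ (R u v v) u / (‖u‖ ^ 2 * ‖v‖ ^ 2 - (inner ℝ u v) ^ 2) = k) {v w n : V}
    (hvn : inner ℝ v n = 0) (hwn : inner ℝ w n = 0) : inner ℝ (R v w v) n = 0 := by
  have hK (u v : V) :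
      inner ℝ (R u v v) u = k * (‖u‖ ^ 2 * ‖v‖ ^ 2 - (inner ℝ u v) ^ 2) := by
    rcases eq_or_ne u 0 with rfl | hu
    · simp
    obtain ⟨-, hgram⟩ := gram_eq hu v
    by_cases huv : LinearIndependent ℝ ![u, v]
    · have hv' := (ne_zero_of_linearIndependent_pair huv (inner ℝ u v / ‖u‖ ^ 2)).2
      have h0 : ‖u‖ ^ 2 * ‖v‖ ^ 2 - (inner ℝ u v) ^ 2 ≠ 0 := by
        rw [hgram]
        have := norm_ne_zero_iff.2 hu
        have := norm_ne_zero_iff.2 hv'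
        positivity
      rw [← hk u v huv, div_mul_cancel₀ _ h0]
    · rw [LinearIndependent.pair_iff' hu] at huv
      push Not at huv
      obtain ⟨c, rfl⟩ := huv
      rw [h.smul₂, h.self₁₂, inner_smul_right, norm_smul, mul_pow, Real.norm_eq_abs, sq_abs,
        real_inner_self_eq_norm_sq]
      simp
      right
      ring
  have h1 := hK v (w + n)
  have h2 := hK v w
  have h3 := hK v n
  rw [h.add₂, h.add₃, h.add₃, inner_add_left, inner_add_left, inner_add_left, inner_add_right, hvn,
    norm_add_sq_real, hwn, h2, h3, hvn] at h1
  have h4 := h.skew v w v n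
  have h5 : inner ℝ (R v n w) v = inner ℝ (R v w n) v := by
    rw [h.pair v n, h.inner_swap, h.skew, neg_neg]
  rw [h4]
  linarith

theorem sum_inner_eq_zero_of_einstein [FiniteDimensional ℝ V] {r : ℕ}
    (hr : r + 1 = Module.finrank ℝ V) {ρ : ℝ} (hρ : ∀ u w, ric R u w = ρ * inner ℝ u w)
    {v : Fin r → V} (hv : Orthonormal ℝ v) {w n : V} (hn : ∀ i, inner ℝ (v i) n = 0)
    (hwn : inner ℝ w n = 0) : ∑ i, inner ℝ (R (v i) w (v i)) n = 0 := by
  rcases eq_or_ne n 0 with rfl | hn0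
  · simp
  have hn' : ∀ i, inner ℝ n (v i) = 0 := fun i => by rw [real_inner_comm, hn i]
  have ho : Orthonormal ℝ (Fin.cons (‖n‖⁻¹ • n) v : Fin (r + 1) → V) := by
    rw [orthonormal_iff_ite] at hv ⊢
    intro i j
    refine Fin.cases ?_ (fun i => ?_) i <;> refine Fin.cases ?_ (fun j => ?_) j
    · simpa using inner_normalize_self hn0
    · simp [inner_smul_left, hn', (Fin.succ_ne_zero j).symm]
    · simp [inner_smul_right, hn]
    · simpa using hv i j
  let b : OrthonormalBasis (Fin (r + 1)) ℝ V := OrthonormalBasis.mk ho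
    (ho.linearIndependent.span_eq_top_of_card_eq_finrank' (by simpa using hr)).ge
  have hb : (b : Fin (r + 1) → V) = Fin.cons (‖n‖⁻¹ • n) v := OrthonormalBasis.coe_mk _ _
  have := hρ w n
  rw [hwn, mul_zero, h.ric_eq_sum b, hb, Fin.sum_univ_succ] at this
  simp only [Fin.cons_zero, Fin.cons_succ, inner_smul_right, h.self₃₄, mul_zero, zero_add] at this
  rw [Finset.sum_congr rfl fun i _ => h.skew (v i) w (v i) n, Finset.sum_neg_distrib, this,
    neg_zero]

end IsCurvatureLike

theorem mem_of_forall_inner_eq_zero [FiniteDimensional ℝ V] {W : Submodule ℝ V} {x : V}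
    (hx : ∀ n, (∀ w ∈ W, inner ℝ w n = 0) → inner ℝ x n = 0) : x ∈ W := by
  rw [← Submodule.orthogonal_orthogonal W, Submodule.mem_orthogonal']
  intro n hn
  exact hx n fun w hw => (Submodule.mem_orthogonal W n).1 hn w hw

end Pointwise

theorem IsCurvatureLike.sum_skew_eq_zero {V : Type*} [NormedAddCommGroup V]
    [InnerProductSpace ℝ V] {R : V → V → V → V} (h : IsCurvatureLike R) {ι : Type*} [Fintype ι]
    (b : OrthonormalBasis ι ℝ V) {A : ι → V}
    (hA : ∀ i l, inner ℝ (A i) (b l) = -inner ℝ (A l) (b i)) (v w : V) :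
    ∑ i, (inner ℝ (R (b i) v w) (A i) + inner ℝ (R (A i) v w) (b i)) = 0 := by
  let L : V →ₗ[ℝ] V :=
    { toFun := fun u => R u v w
      map_add' := fun u u' => h.add₁ u u' v w
      map_smul' := fun c u => h.smul₁ c u v w }
  have h1 (i : ι) : inner ℝ (L (b i)) (A i) = ∑ l, inner ℝ (A i) (b l) * inner ℝ (L (b i)) (b l) := by
    rw [← b.sum_inner_mul_inner]
    exact Finset.sum_congr rfl fun l _ => by rw [mul_comm, real_inner_comm (A i)]
  have h2 (i : ι) : inner ℝ (L (A i)) (b i) = ∑ l, inner ℝ (A i) (b l) * inner ℝ (L (b l)) (b i) := by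
    conv_lhs => rw [← b.sum_repr (A i), map_sum, sum_inner]
    refine Finset.sum_congr rfl fun l _ => ?_
    rw [map_smul, inner_smul_left, b.repr_apply_apply, real_inner_comm (A i), conj_trivial]
  change ∑ i, (inner ℝ (L (b i)) (A i) + inner ℝ (L (A i)) (b i)) = 0
  rw [Finset.sum_add_distrib, Finset.sum_congr rfl fun i _ => h2 i, Finset.sum_comm,
    ← Finset.sum_add_distrib]
  refine Finset.sum_eq_zero fun i _ => ?_
  rw [h1, ← Finset.sum_add_distrib]
  exact Finset.sum_eq_zero fun l _ => by rw [hA i l]; ring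

section Constant

variable {E : Type*} [NormedAddCommGroup E] [NormedSpace ℝ E]
  {H : Type*} [TopologicalSpace H] {I : ModelWithCorners ℝ E H} [I.Boundaryless]
  {M : Type*} [TopologicalSpace M] [ChartedSpace H M] [IsManifold I ∞ M]

/-- A function with vanishing differential on a connected manifold is constant. -/
theorem eq_of_mvfderiv_eq_zero [PreconnectedSpace M] {f : M → ℝ} (hf : ∀ x, MDiffAt f x)
    (h0 : ∀ x, d% f x = 0) (x y : M) : f x = f y := by
  refine IsLocallyConstant.apply_eq_of_preconnectedSpace ?_ x y
  rw [IsLocallyConstant.iff_eventually_eq]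
  intro x
  let φ := extChartAt I x
  have hopen : IsOpen φ.target := isOpen_extChartAt_target x
  obtain ⟨r, hr, hball⟩ := Metric.isOpen_iff.1 hopen (φ x) (mem_extChartAt_target x)
  have hd (z : E) (hz : z ∈ φ.target) : HasFDerivAt (f ∘ φ.symm) (0 : E →L[ℝ] ℝ) z := by
    have hsymm : MDiffAt φ.symm z :=
      ((contMDiffOn_extChartAt_symm (n := ∞) x).contMDiffAt (hopen.mem_nhds hz)).mdifferentiableAt
        (by simp)
    have h := (hf (φ.symm z)).hasMFDerivAt.comp z hsymm.hasMFDerivAt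
    have hz0 : mfderiv I 𝓘(ℝ, ℝ) f (φ.symm z) = 0 := h0 (φ.symm z)
    rw [hz0, ContinuousLinearMap.zero_comp] at h
    exact h.hasFDerivAt
  obtain ⟨a, ha⟩ := Metric.isOpen_ball.exists_is_const_of_fderiv_eq_zero
    (convex_ball (φ x) r).isPreconnected
    (fun z hz => (hd z (hball hz)).differentiableAt.differentiableWithinAt)
    (fun z hz => (hd z (hball hz)).fderiv)
  have hev : ∀ᶠ y in 𝓝 x, f y = a := by
    filter_upwards [(continuousAt_extChartAt (I := I) x).eventually (Metric.ball_mem_nhds _ hr),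
      extChartAt_source_mem_nhds (I := I) x] with y hy hys
    have := ha _ hy
    rwa [Function.comp_apply, φ.left_inv hys] at this
  filter_upwards [hev] with y hy
  rw [hy, hev.self_of_nhds]

end Constant

section Schur

variable {E : Type*} [NormedAddCommGroup E] [NormedSpace ℝ E] [FiniteDimensional ℝ E]
  {H : Type*} [TopologicalSpace H] {I : ModelWithCorners ℝ E H}
  {M : Type*} [TopologicalSpace M] [T2Space M] [ChartedSpace H M] [IsManifold I ∞ M]
  [RiemannianBundle (fun x : M => TangentSpace I x)]
  [IsContMDiffRiemannianBundle I ∞ E (fun x : M => TangentSpace I x)]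

theorem isCurvatureLike_curvature (x : M) :
    IsCurvatureLike (V := TangentSpace I x) (curvature I x) where
  swap u v w := by
    obtain ⟨X, rfl⟩ := exists_smooth_field u
    obtain ⟨Y, rfl⟩ := exists_smooth_field v
    obtain ⟨Z, rfl⟩ := exists_smooth_field w
    rw [curvature_eq, curvature_eq, curv_swap]
    rfl
  skew u v w z := by
    obtain ⟨X, rfl⟩ := exists_smooth_field u
    obtain ⟨Y, rfl⟩ := exists_smooth_field v
    obtain ⟨Z, rfl⟩ := exists_smooth_field w
    obtain ⟨W, rfl⟩ := exists_smooth_field z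
    rw [curvature_eq, curvature_eq]
    exact congr($(ip_curv_skew X Y Z W) x)
  bianchi u v w := by
    obtain ⟨X, rfl⟩ := exists_smooth_field u
    obtain ⟨Y, rfl⟩ := exists_smooth_field v
    obtain ⟨Z, rfl⟩ := exists_smooth_field w
    rw [curvature_eq, curvature_eq, curvature_eq]
    exact congr($(curv_bianchi X Y Z) x)

theorem dir_congr {X : Cₛ^∞⟮I; E, (TangentSpace I : M → Type _)⟯} {f g : C^∞⟮I, M; ℝ⟯} {x : M}
    (h : ∀ᶠ y in 𝓝 x, f y = g y) : dir X f x = dir X g x :=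
  congr($(Filter.EventuallyEq.mfderiv_eq (I := I) (I' := 𝓘(ℝ, ℝ)) h) (X x))

theorem dir_const (X : Cₛ^∞⟮I; E, (TangentSpace I : M → Type _)⟯) {f : C^∞⟮I, M; ℝ⟯} {x : M} {c : ℝ}
    (h : ∀ᶠ y in 𝓝 x, f y = c) : dir X f x = 0 := by
  rw [dir_congr (g := ContMDiffMap.const c) h, dir_apply]
  have : d% (⇑(ContMDiffMap.const c : C^∞⟮I, M; ℝ⟯)) x = 0 := mvfderiv_const c
  rw [this]
  rfl

theorem smooth_sum_apply {ι : Type*} (s : Finset ι) (f : ι → C^∞⟮I, M; ℝ⟯) (x : M) :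
    (∑ i ∈ s, f i) x = ∑ i ∈ s, f i x :=
  map_sum (⟨⟨fun g : C^∞⟮I, M; ℝ⟯ => g x, rfl⟩, fun _ _ => rfl⟩ : C^∞⟮I, M; ℝ⟯ →+ ℝ) f s

theorem dir_sum {ι : Type*} (s : Finset ι) (X : Cₛ^∞⟮I; E, (TangentSpace I : M → Type _)⟯)
    (f : ι → C^∞⟮I, M; ℝ⟯) : dir X (∑ i ∈ s, f i) = ∑ i ∈ s, dir X (f i) :=
  map_sum (AddMonoidHom.mk' (dir X) (dir_add X)) f s

theorem nablaCurv_swap (X Y Z W : Cₛ^∞⟮I; E, (TangentSpace I : M → Type _)⟯) :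
    nablaCurv X Y Z W = -nablaCurv X Z Y W := by
  have : nabla X (-curv Z Y W) = -nabla X (curv Z Y W) := map_neg (nablaHom X) _
  rw [nablaCurv, nablaCurv, curv_swap Y Z W, curv_swap (nabla X Y), curv_swap Y (nabla X Z),
    curv_swap Y Z, this]
  abel

theorem ip_nablaCurv_skew (X Y Z W U : Cₛ^∞⟮I; E, (TangentSpace I : M → Type _)⟯) :
    ip (nablaCurv X Y Z W) U = -ip (nablaCurv X Y Z U) W := by
  have h0 : dir X (ip (curv Y Z W) U) + dir X (ip (curv Y Z U) W) = 0 := by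
    rw [← dir_add, ip_curv_skew Y Z W U, neg_add_cancel]
    ext x
    exact dir_const X (c := 0) (Filter.Eventually.of_forall fun y => rfl)
  rw [dir_ip, dir_ip, ip_curv_skew Y Z W (nabla X U), ip_curv_skew Y Z U (nabla X W)] at h0
  simp only [nablaCurv, ip_sub_left]
  rw [ip_curv_skew (nabla X Y) Z W U, ip_curv_skew Y (nabla X Z) W U]
  linear_combination h0

/-- The contracted second Bianchi identity for a Ricci form proportional to the metric. -/
theorem mvfderiv_eq_zero_of_ricci_eq (hm : 3 ≤ Module.finrank ℝ E) {ρ : M → ℝ}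
    (hρ : ∀ (x : M) (u w : TangentSpace I x), ricci I x u w = ρ x * inner ℝ u w) (x : M) :
    MDiffAt ρ x ∧ d% ρ x = 0 := by
  obtain ⟨e, he⟩ := exists_smooth_frame (I := I) x
  have hric : ∀ᶠ y in 𝓝 x, ∀ Y W : Cₛ^∞⟮I; E, (TangentSpace I : M → Type _)⟯,
      ∑ i, inner ℝ (curv (e i) Y W y) (e i y) = ρ y * inner ℝ (Y y) (W y) := by
    filter_upwards [he] with y ⟨b, hb⟩ Y W
    rw [← hρ]
    refine Eq.trans ?_ ((isCurvatureLike_curvature y).ric_eq_sum b (Y y) (W y)).symm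
    refine Finset.sum_congr rfl fun i _ => ?_
    rw [hb, curvature_eq]
  have hort : ∀ᶠ y in 𝓝 x, ∀ i j, inner ℝ (e i y) (e j y) = if i = j then (1 : ℝ) else 0 := by
    filter_upwards [he] with y ⟨b, hb⟩ i j
    rw [← hb, ← hb, orthonormal_iff_ite.1 b.orthonormal]
  obtain ⟨b, hb⟩ := he.self_of_nhds
  let S (j k : Fin (Module.finrank ℝ E)) : C^∞⟮I, M; ℝ⟯ :=
    ∑ i, ip (curv (e i) (e j) (e k)) (e i)
  have hS (j k) : ∀ᶠ y in 𝓝 x, S j k y = ρ y * if j = k then (1 : ℝ) else 0 := by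
    filter_upwards [hric, hort] with y h1 h2
    rw [← h2, ← h1, smooth_sum_apply]
    rfl
  let o : Fin (Module.finrank ℝ E) := ⟨0, by omega⟩
  have hP : ∀ᶠ y in 𝓝 x, ρ y = S o o y := by
    filter_upwards [hS o o] with y h
    simpa using h.symm
  let D (a : Fin (Module.finrank ℝ E)) : ℝ := dir (e a) (S o o) x
  have hDS (a j k) : dir (e a) (S j k) x = if j = k then D a else 0 := by
    split_ifs with hjk
    · refine dir_congr ?_
      filter_upwards [hP, hS j k] with y h1 h2
      rw [h2, if_pos hjk, mul_one, h1]
    · refine dir_const _ (c := 0) ?_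
      filter_upwards [hS j k] with y h2
      rw [h2, if_neg hjk, mul_zero]
  have hω (a i l) : inner ℝ (nabla (e a) (e i) x) (e l x) = -inner ℝ (nabla (e a) (e l) x) (e i x) := by
    have h1 : dir (e a) (ip (e i) (e l)) x = 0 :=
      dir_const _ (hort.mono fun y hy => hy i l)
    rw [dir_ip] at h1
    have h2 : inner ℝ (nabla (e a) (e i) x) (e l x) + inner ℝ (e i x) (nabla (e a) (e l) x) = 0 := h1
    rw [real_inner_comm _ (e i x)] at h2
    linarith
  let T (a i j k l : Fin (Module.finrank ℝ E)) : ℝ :=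
    inner ℝ (nablaCurv (e a) (e i) (e j) (e k) x) (e l x)
  have htr (a j k) : ∑ i, T a i j k i = if j = k then D a else 0 := by
    have h1 := hDS a j k
    rw [dir_sum, smooth_sum_apply] at h1
    simp only [dir_ip] at h1
    have h2 := (isCurvatureLike_curvature x).sum_skew_eq_zero b
      (A := fun i => nabla (e a) (e i) x) (fun i l => by rw [hb, hb, hω]) (e j x) (e k x)
    have h3 := hric.self_of_nhds (nabla (e a) (e j)) (e k)
    have h4 := hric.self_of_nhds (e j) (nabla (e a) (e k))
    simp only [hb, curvature_eq] at h2
    have h5 : inner ℝ (nabla (e a) (e j) x) (e k x) + inner ℝ (e j x) (nabla (e a) (e k) x) = 0 := by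
      rw [hω, real_inner_comm, neg_add_cancel]
    have hT (i) : T a i j k i = (inner ℝ (nabla (e a) (curv (e i) (e j) (e k)) x) (e i x)
          + inner ℝ (curv (e i) (e j) (e k) x) (nabla (e a) (e i) x))
        - (inner ℝ (curv (e i) (e j) (e k) x) (nabla (e a) (e i) x)
          + inner ℝ (curv (nabla (e a) (e i)) (e j) (e k) x) (e i x))
        - inner ℝ (curv (e i) (nabla (e a) (e j)) (e k) x) (e i x)
        - inner ℝ (curv (e i) (e j) (nabla (e a) (e k)) x) (e i x) := by
      simp only [T, nablaCurv, ContMDiffSection.coe_sub, Pi.sub_apply, inner_sub_left]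
      ring
    rw [Finset.sum_congr rfl fun i _ => hT i, Finset.sum_sub_distrib, Finset.sum_sub_distrib,
      Finset.sum_sub_distrib, h2, h3, h4, ← h1]
    change _ = ∑ i, (inner ℝ (nabla (e a) (curv (e i) (e j) (e k)) x) (e i x)
          + inner ℝ (curv (e i) (e j) (e k) x) (nabla (e a) (e i) x))
    linear_combination -(ρ x) * h5
  have hTswap (a i j k l) : T a i j k l = -T a j i k l := by
    simp only [T]
    rw [nablaCurv_swap, ContMDiffSection.coe_neg, Pi.neg_apply, inner_neg_left]
  have hTskew (a i j k l) : T a i j k l = -T a i j l k :=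
    congr($(ip_nablaCurv_skew (e a) (e i) (e j) (e k) (e l)) x)
  have hTbianchi (a i j k l) : T a i j k l + T i j a k l + T j a i k l = 0 := by
    simp only [T, ← inner_add_left]
    have : nablaCurv (e a) (e i) (e j) (e k) x + nablaCurv (e i) (e j) (e a) (e k) x
        + nablaCurv (e j) (e a) (e i) (e k) x = 0 :=
      congr($(second_bianchi (e a) (e i) (e j) (e k)) x)
    rw [this, inner_zero_left]
  have hD (a) : D a = 0 := by
    have h1 : ∑ j, ∑ i, T a i j j i = Module.finrank ℝ E * D a := by
      simp [htr]
    have h2 : ∑ j, ∑ i, T i j a j i = -D a := by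
      have hsum (i) : ∑ j, T i j a j i = -if a = i then D i else 0 := by
        rw [← htr i a i, ← Finset.sum_neg_distrib]
        exact Finset.sum_congr rfl fun j _ => hTskew _ _ _ _ _
      rw [Finset.sum_comm]
      simp [hsum]
    have h3 : ∑ j, ∑ i, T j a i j i = -D a := by
      have hsum (j) : ∑ i, T j a i j i = -if a = j then D j else 0 := by
        rw [← htr j a j, ← Finset.sum_neg_distrib]
        exact Finset.sum_congr rfl fun i _ => hTswap _ _ _ _ _
      simp [hsum]
    have h4 : ∑ j, ∑ i, (T a i j j i + T i j a j i + T j a i j i) = 0 :=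
      Finset.sum_eq_zero fun j _ => Finset.sum_eq_zero fun i _ => hTbianchi _ _ _ _ _
    simp only [Finset.sum_add_distrib, h1, h2, h3] at h4
    have hm' : (3 : ℝ) ≤ Module.finrank ℝ E := by exact_mod_cast hm
    have h5 : ((Module.finrank ℝ E : ℝ) - 2) * D a = 0 := by linear_combination h4
    exact (mul_eq_zero.1 h5).resolve_left (by linarith)
  have hmd : MDiffAt ρ x :=
    (smooth_mdifferentiableAt (S o o) x).congr_of_eventuallyEq hP
  have hd : d% ρ x = d% (S o o) x :=
    Filter.EventuallyEq.mfderiv_eq (I := I) (I' := 𝓘(ℝ, ℝ)) hP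
  refine ⟨hmd, ?_⟩
  have hlin : (d% ρ x).toLinearMap = 0 := by
    refine b.toBasis.ext fun a => ?_
    rw [b.coe_toBasis, hb, hd]
    exact hD a
  ext u
  exact congr($hlin u)

end Schur

section Submanifolds

universe u v

variable {E : Type*} [NormedAddCommGroup E] [NormedSpace ℝ E] [FiniteDimensional ℝ E]
  {H : Type*} [TopologicalSpace H] {I : ModelWithCorners ℝ E H}
  {M : Type u} [TopologicalSpace M] [T2Space M] [ChartedSpace H M] [IsManifold I ∞ M]
  [RiemannianBundle (fun x : M => TangentSpace I x)]
  [IsContMDiffRiemannianBundle I ∞ E (fun x : M => TangentSpace I x)]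

theorem isEinstein_of_ricci_orthogonal [I.Boundaryless] [ConnectedSpace M]
    (hm : 3 ≤ Module.finrank ℝ E)
    (h : ∀ (x : M) (w n : TangentSpace I x), inner ℝ w n = 0 → ricci I x w n = 0) :
    IsEinstein I M := by
  choose ρ hρ using fun x : M => (isCurvatureLike_curvature (I := I) x).exists_ric_eq (h x)
  have hs := mvfderiv_eq_zero_of_ricci_eq hm hρ
  obtain ⟨x₀⟩ : Nonempty M := inferInstance
  refine ⟨ρ x₀, fun x u w => ?_⟩
  rw [eq_of_mvfderiv_eq_zero (fun x => (hs x).1) (fun x => (hs x).2) x₀ x]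
  exact hρ x u w

theorem hasConstantSectionalCurvature_of_preservesPlanes [I.Boundaryless] [ConnectedSpace M]
    (hm : 3 ≤ Module.finrank ℝ E)
    (h : ∀ x : M, PreservesPlanes (V := TangentSpace I x) (curvature I x)) :
    HasConstantSectionalCurvature I M := by
  obtain ⟨ρ, hρ⟩ := isEinstein_of_ricci_orthogonal (I := I) (M := M) hm fun x =>
    (isCurvatureLike_curvature x).ric_eq_zero_of_preservesPlanes (h x)
  refine ⟨ρ / (Module.finrank ℝ E - 1), fun x u v huv => ?_⟩
  exact (isCurvatureLike_curvature x).sectional_eq_of_ric (h x)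
    (by rw [finrank_tangentSpace]; omega) (hρ x) huv

theorem exists_orthonormalBasis_lift {r : ℕ} {S : Type*} [TopologicalSpace S]
    [ChartedSpace (EuclideanSpace ℝ (Fin r)) S] [IsManifold (𝓡 r) ∞ S]
    [RiemannianBundle (fun q : S => TangentSpace (𝓡 r) q)]
    {f : S → M} (hf : IsIsometricImmersion I r f) {q : S} {T : Finset (TangentSpace I (f q))}
    (hT : Orthonormal ℝ ((↑) : T → TangentSpace I (f q))) (hc : T.card = r)
    (hW : tangentImage I r f q = Submodule.span ℝ (T : Set (TangentSpace I (f q)))) :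
    ∃ (σ : Fin r ≃ T) (b : OrthonormalBasis (Fin r) ℝ (TangentSpace (𝓡 r) q)),
      ∀ i, mfderiv (𝓡 r) I f q (b i) = σ i := by
  classical
  let σ := (T.equivFinOfCardEq hc).symm
  have hmem (i : Fin r) : (σ i : TangentSpace I (f q)) ∈ tangentImage I r f q := by
    rw [hW]
    exact Submodule.subset_span (σ i).2
  choose v hv using hmem
  have hv' (i : Fin r) : mfderiv (𝓡 r) I f q (v i) = σ i := hv i
  have ho : Orthonormal ℝ v := by
    rw [orthonormal_iff_ite] at hT ⊢
    intro i j
    rw [← hf.2 q, hv', hv', hT]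
    simp
  have hfin : Fintype.card (Fin r) = Module.finrank ℝ (TangentSpace (𝓡 r) q) := by
    rw [finrank_tangentSpace]
    simp
  refine ⟨σ, OrthonormalBasis.mk ho
    (ho.linearIndependent.span_eq_top_of_card_eq_finrank' hfin).ge, fun i => ?_⟩
  rw [OrthonormalBasis.coe_mk, hv']

theorem AxiomSpecial.specialOn {r : ℕ} (h : AxiomSpecial I M r) (p : M) :
    SpecialOn (V := TangentSpace I p) (curvature I p) r := by
  intro T hT hc w hw z hz
  obtain ⟨S, _, _, _, _, _, _, _, f, hf, hs, q, hq, hW⟩ :=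
    h p (Submodule.span ℝ (T : Set (TangentSpace I p)))
      (by rw [finrank_span_finset_eq_card hT.linearIndependent, hc])
  subst hq
  obtain ⟨σ, b, hb⟩ := exists_orthonormalBasis_lift hf hT hc hW
  have hmem := hs q b (b (σ.symm ⟨w, hw⟩))
  rw [show tangentImage I r f q = _ from hW] at hmem
  simp only [hb, Equiv.apply_symm_apply] at hmem
  have hz' : z ∈ (Submodule.span ℝ (T : Set (TangentSpace I (f q))))ᗮ := by
    rw [Submodule.mem_orthogonal]
    intro u hu
    induction hu using Submodule.span_induction with
    | mem x hx => exact hz x hx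
    | zero => exact inner_zero_left _
    | add x y _ _ hx hy => rw [inner_add_left, hx, hy, add_zero]
    | smul a x _ hx => rw [inner_smul_left, hx, mul_zero]
  have h0 := (Submodule.mem_orthogonal _ z).1 hz' _ hmem
  rw [sum_inner, Equiv.sum_comp σ fun v : T => inner ℝ (curvature I (f q) v w v) z] at h0
  rwa [← Finset.sum_coe_sort T]

theorem AxiomVerySpecial.preservesPlanes (hm : 1 ≤ Module.finrank ℝ E)
    (h : AxiomVerySpecial I M (Module.finrank ℝ E - 1)) (p : M) :
    PreservesPlanes (V := TangentSpace I p) (curvature I p) := by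
  intro u v n _ hun hvn
  rcases eq_or_ne n 0 with rfl | hn
  · exact inner_zero_right _
  have hfin : Module.finrank ℝ (Submodule.span ℝ {n})ᗮ = Module.finrank ℝ E - 1 := by
    have h1 := (Submodule.span ℝ {n}).finrank_add_finrank_orthogonal
    rw [finrank_span_singleton hn, finrank_tangentSpace] at h1
    omega
  obtain ⟨S, _, _, _, _, _, _, _, f, hf, hs, q, hq, hW⟩ := h p _ hfin
  subst hq
  replace hW : tangentImage I (Module.finrank ℝ E - 1) f q = (Submodule.span ℝ {n})ᗮ := hW
  have hu : u ∈ tangentImage I (Module.finrank ℝ E - 1) f q := by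
    rw [hW, Submodule.mem_orthogonal_singleton_iff_inner_left]
    exact hun
  have hv : v ∈ tangentImage I (Module.finrank ℝ E - 1) f q := by
    rw [hW, Submodule.mem_orthogonal_singleton_iff_inner_left]
    exact hvn
  obtain ⟨u, rfl⟩ := hu
  obtain ⟨v, rfl⟩ := hv
  have := hs q u v
  rw [hW, Submodule.mem_orthogonal_singleton_iff_inner_left] at this
  exact this

variable {r : ℕ} {S : Type v} [TopologicalSpace S]
  [ChartedSpace (EuclideanSpace ℝ (Fin r)) S] [IsManifold (𝓡 r) ∞ S]
  [RiemannianBundle (fun q : S => TangentSpace (𝓡 r) q)] {f : S → M}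

theorem HasConstantSectionalCurvature.isVerySpecial (h : HasConstantSectionalCurvature I M) :
    IsVerySpecial I r f := by
  obtain ⟨k, hk⟩ := h
  intro p v w
  refine mem_of_forall_inner_eq_zero fun n hn => ?_
  exact (isCurvatureLike_curvature (f p)).inner_eq_zero_of_sectional (hk (f p)) (hn _ ⟨v, rfl⟩)
    (hn _ ⟨w, rfl⟩)

theorem IsEinstein.isSpecial (h : IsEinstein I M) (hr : r + 1 = Module.finrank ℝ E)
    (hf : IsIsometricImmersion I r f) : IsSpecial I r f := by
  obtain ⟨ρ, hρ⟩ := h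
  intro p v w
  refine mem_of_forall_inner_eq_zero fun n hn => ?_
  rw [sum_inner]
  refine (isCurvatureLike_curvature (f p)).sum_inner_eq_zero_of_einstein
    (hr.trans (finrank_tangentSpace _).symm) (hρ (f p)) ?_ (fun i => hn _ ⟨v i, rfl⟩)
    (hn _ ⟨w, rfl⟩)
  rw [orthonormal_iff_ite]
  intro i j
  rw [hf.2, orthonormal_iff_ite.1 v.orthonormal]

end Submanifolds

end RiemGeom

end

universe u v

theorem theorem1p1 (m : ℕ) (M : Type u) [TopologicalSpace M] [T2Space M]
    [SecondCountableTopology M] [ChartedSpace (EuclideanSpace ℝ (Fin m)) M]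
    [IsManifold (𝓡 m) ∞ M] [RiemannianBundle (fun x : M => TangentSpace (𝓡 m) x)]
    [IsContMDiffRiemannianBundle (𝓡 m) ∞ (EuclideanSpace ℝ (Fin m))
      (fun x : M => TangentSpace (𝓡 m) x)] :
    (3 ≤ m → ConnectedSpace M →
      (∀ r : ℕ, 2 ≤ r → r ≤ m - 1 → RiemGeom.AxiomSpecial (𝓡 m) M r →
        (r ≤ m - 2 → RiemGeom.HasConstantSectionalCurvature (𝓡 m) M) ∧
        (r = m - 1 → RiemGeom.IsEinstein (𝓡 m) M)) ∧
      (RiemGeom.AxiomVerySpecial (𝓡 m) M (m - 1) →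
        RiemGeom.HasConstantSectionalCurvature (𝓡 m) M)) ∧
    (∀ (r : ℕ) (S : Type v) [TopologicalSpace S] [T2Space S] [SecondCountableTopology S]
      [ChartedSpace (EuclideanSpace ℝ (Fin r)) S] [IsManifold (𝓡 r) ∞ S]
      [RiemannianBundle (fun q : S => TangentSpace (𝓡 r) q)]
      [IsContMDiffRiemannianBundle (𝓡 r) ∞ (EuclideanSpace ℝ (Fin r))
        (fun q : S => TangentSpace (𝓡 r) q)]
      (f : S → M), RiemGeom.IsIsometricImmersion (𝓡 m) r f →
        (RiemGeom.HasConstantSectionalCurvature (𝓡 m) M → RiemGeom.IsVerySpecial (𝓡 m) r f) ∧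
        (RiemGeom.IsEinstein (𝓡 m) M → r + 1 = m → RiemGeom.IsSpecial (𝓡 m) r f)) := by
  have hfin : Module.finrank ℝ (EuclideanSpace ℝ (Fin m)) = m := finrank_euclideanSpace_fin
  refine ⟨fun hm _ => ⟨fun r hr2 _ h => ⟨fun hr => ?_, fun hr => ?_⟩, fun h => ?_⟩,
    fun r S _ _ _ _ _ _ _ f hf => ⟨fun h => h.isVerySpecial, fun h hr =>
      h.isSpecial (hr.trans hfin.symm) hf⟩⟩
  · refine RiemGeom.hasConstantSectionalCurvature_of_preservesPlanes (hm.trans hfin.ge) fun x => ?_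
    refine (RiemGeom.isCurvatureLike_curvature x).preservesPlanes_of_special hr2 ?_ (h.specialOn x)
    rw [RiemGeom.finrank_tangentSpace, hfin]
    omega
  · refine RiemGeom.isEinstein_of_ricci_orthogonal (hm.trans hfin.ge) fun x => ?_
    refine (RiemGeom.isCurvatureLike_curvature x).ric_eq_zero_of_special ?_ (h.specialOn x)
    rw [RiemGeom.finrank_tangentSpace, hfin]
    omega
  · refine RiemGeom.hasConstantSectionalCurvature_of_preservesPlanes (hm.trans hfin.ge) fun x => ?_
    refine RiemGeom.AxiomVerySpecial.preservesPlanes (by omega) ?_ x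
    rwa [hfin]
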